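/- Let $(M,g)$ be a globally hyperbolic spacetime: $M$ is a four-dimensional, Hausdorff, second countable smooth manifold, $g$ is a smooth Lorentzian metric of signature $(-,+,+,+)$ with a fixed time orientation, and $M$ contains a Cauchy hypersurface (a closed achronal set whose domain of dependence is all of $M$). Let $J^\pm(\Omega)$ be the causal future/past of $\Omega\subseteq M$ (with $\Omega\subseteq J^\pm(\Omega)$), and $J(\Omega)=J^+(\Omega)\cup J^-(\Omega)$. Let $E\to M$ be a smooth real vector bundle of finite rank, endowed with a smooth non-degenerate symmetric or antisymmetric bilinear form $\langle\cdot,\cdot\rangle$ on its fibres. Let $\Gamma(M,E)$ be the space of smooth sections, $\Gamma_0(M,E)$ the subspace of compactly supported ones, and $(u,v)=\int_M\langle u,v\rangle\,\mathrm{vol}_M$, where $\mathrm{vol}_M$ is the volume measure of $g$ (orientability of $M$ is not needed). Let $P:\Gamma(M,E)\to\Gamma(M,E)$ be a linear partial differential operator with smooth coefficients. An advanced (resp. retarded) Green operator for $P$ is a linear map $G^{+}$ (resp. $G^-$) $:\Gamma_0(M,E)\to\Gamma(M,E)$ such that, for all $f\in\Gamma_0(M,E)$, $PG^\pm f=f$,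 $G^\pm Pf=f$ and $\mathrm{supp}(G^\pm f)\subseteq J^\pm(\mathrm{supp} f)$; $P$ is Green-hyperbolic if it admits an advanced and a retarded Green operator. The formal adjoint of $P$ is the linear differential operator $P^*$ on $\Gamma(M,E)$ with $(P^*u,v)=(u,Pv)$ for all $u,v\in\Gamma(M,E)$ such that $\mathrm{supp}(u)\cap\mathrm{supp}(v)$ is compact. Suppose that $P$ and its formal adjoint $P^*$ are both Green-hyperbolic. Then the causal propagator $G=G^+-G^-$ of $P$ is unique. Let $\mathcal S_{sc}(M)$ be the vector space of all $u\in\Gamma(M,E)$ with $Pu=0$ and $\mathrm{supp}(u)\subseteq J(K)$ for some compact $K\subseteq M$. Then $$I:\Gamma_0(M,E)/P(\Gamma_0(M,E))\to\mathcal S_{sc}(M),\qquad [f]\mapsto Gf,$$ is a well-defined isomorphism of vector spaces. -/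

import Mathlib

open Bundle MeasureTheory Set Topology
open scoped Manifold ContDiff Bundle

noncomputable section

namespace QFTCurved

/-- The model space `ℝ⁴`, with its Euclidean norm and Lebesgue measure. -/
abbrev E4 : Type := EuclideanSpace ℝ (Fin 4)

/-! ### Time-oriented Lorentzian four-manifolds -/

section Geometry

variable {M : Type*} [TopologicalSpace M] [ChartedSpace E4 M] [IsManifold (𝓡 4) ∞ M]

variable (M) in
/-- A smooth Lorentzian metric of signature `(-,+,+,+)` on a smooth four-manifold `M`, together
with a time orientation, given by a smooth vector field that is timelike everywhere. -/
structure Spacetime where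
  /-- The metric tensor. -/
  metric : ∀ x : M, TangentSpace (𝓡 4) x →L[ℝ] TangentSpace (𝓡 4) x →L[ℝ] ℝ
  symm : ∀ (x : M) (v w : TangentSpace (𝓡 4) x), metric x v w = metric x w v
  signature : ∀ x : M, ∃ e : Module.Basis (Fin 4) ℝ (TangentSpace (𝓡 4) x),
    ∀ i j, metric x (e i) (e j) = Matrix.diagonal ![(-1 : ℝ), 1, 1, 1] i j
  contMDiff_metric : ContMDiff (𝓡 4) ((𝓡 4).prod 𝓘(ℝ, E4 →L[ℝ] E4 →L[ℝ] ℝ)) ∞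
    (fun x ↦ TotalSpace.mk' (E4 →L[ℝ] E4 →L[ℝ] ℝ)
      (E := fun x : M ↦ TangentSpace (𝓡 4) x →L[ℝ] TangentSpace (𝓡 4) x →L[ℝ] ℝ) x (metric x))
  /-- The vector field that fixes the time orientation. -/
  timeField : ∀ x : M, TangentSpace (𝓡 4) x
  contMDiff_timeField : ContMDiff (𝓡 4) (𝓡 4).tangent ∞
    (fun x ↦ (⟨x, timeField x⟩ : TangentBundle (𝓡 4) M))
  timelike_timeField : ∀ x : M, metric x (timeField x) (timeField x) < 0

namespace Spacetime

variable (g : Spacetime M)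

/-- A tangent vector is future-directed causal if it is timelike or lightlike and lies in the
fold of the light cone that contains the time orientation. (The last inequality excludes the
zero vector.) -/
def FutureCausal (x : M) (v : TangentSpace (𝓡 4) x) : Prop :=
  g.metric x v v ≤ 0 ∧ g.metric x (g.timeField x) v < 0

/-- A tangent vector is future-directed timelike. -/
def FutureTimelike (x : M) (v : TangentSpace (𝓡 4) x) : Prop :=
  g.metric x v v < 0 ∧ g.metric x (g.timeField x) v < 0

end Spacetime

/-- `γ`, restricted to the interval `s`, is a piecewise smooth curve all of whose tangent vectors
(both one-sided ones at a break point) satisfy `C`. The set `B` of break points is finite in every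
compact subinterval of `s`. -/
def IsPiecewiseSmoothCurve (C : ∀ x : M, TangentSpace (𝓡 4) x → Prop) (γ : ℝ → M) (s : Set ℝ) :
    Prop :=
  ContinuousOn γ s ∧ ∃ B : Set ℝ, (∀ a b, Icc a b ⊆ s → (B ∩ Icc a b).Finite) ∧
    ∀ a b, a < b → Icc a b ⊆ s → Disjoint (Ioo a b) B →
      ContMDiffOn 𝓘(ℝ, ℝ) (𝓡 4) ∞ γ (Icc a b) ∧
      ∀ t ∈ Icc a b, C (γ t) (mfderivWithin 𝓘(ℝ, ℝ) (𝓡 4) γ (Icc a b) t (1 : ℝ))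

/-- The curve `γ` on the interval `s` has no past endpoint, i.e. it is past-inextensible. -/
def PastInextensible (γ : ℝ → M) (s : Set ℝ) : Prop :=
  ¬ ∃ p : M, ∀ U ∈ 𝓝 p, ∃ t₀ ∈ s, ∀ t ∈ s, t ≤ t₀ → γ t ∈ U

/-- The curve `γ` on the interval `s` has no future endpoint, i.e. it is future-inextensible. -/
def FutureInextensible (γ : ℝ → M) (s : Set ℝ) : Prop :=
  ¬ ∃ p : M, ∀ U ∈ 𝓝 p, ∃ t₀ ∈ s, ∀ t ∈ s, t₀ ≤ t → γ t ∈ U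

namespace Spacetime

variable (g : Spacetime M)

/-- `q` is in the causal future of `p`: `q = p`, or `q` can be reached from `p` by a
future-directed causal curve. -/
def CausallyPrecedes (p q : M) : Prop :=
  p = q ∨ ∃ γ : ℝ → M, IsPiecewiseSmoothCurve g.FutureCausal γ (Icc 0 1) ∧ γ 0 = p ∧ γ 1 = q

/-- `q` can be reached from `p` by a future-directed timelike curve. -/
def ChronologicallyPrecedes (p q : M) : Prop :=
  ∃ γ : ℝ → M, IsPiecewiseSmoothCurve g.FutureTimelike γ (Icc 0 1) ∧ γ 0 = p ∧ γ 1 = q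

/-- The causal future `J⁺(Ω)`. -/
def causalFuture (Ω : Set M) : Set M := {q | ∃ p ∈ Ω, g.CausallyPrecedes p q}

/-- The causal past `J⁻(Ω)`. -/
def causalPast (Ω : Set M) : Set M := {q | ∃ p ∈ Ω, g.CausallyPrecedes q p}

/-- `J(Ω) = J⁺(Ω) ∪ J⁻(Ω)`. -/
def causalHull (Ω : Set M) : Set M := g.causalFuture Ω ∪ g.causalPast Ω

/-- The chronological future `I⁺(Ω)`. -/
def chronologicalFuture (Ω : Set M) : Set M := {q | ∃ p ∈ Ω, g.ChronologicallyPrecedes p q}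

/-- A set that no timelike curve meets twice. -/
def IsAchronal (S : Set M) : Prop := g.chronologicalFuture S ∩ S = ∅

/-- The future domain of dependence `D⁺(S)`: every past-inextensible (future-directed) causal curve
through the point meets `S`. -/
def futureDomain (S : Set M) : Set M :=
  {p | ∀ (γ : ℝ → M) (s : Set ℝ), s.OrdConnected → IsPiecewiseSmoothCurve g.FutureCausal γ s →
    PastInextensible γ s → p ∈ γ '' s → (γ '' s ∩ S).Nonempty}

/-- The past domain of dependence `D⁻(S)`. -/
def pastDomain (S : Set M) : Set M :=
  {p | ∀ (γ : ℝ → M) (s : Set ℝ), s.OrdConnected → IsPiecewiseSmoothCurve g.FutureCausal γ s →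
    FutureInextensible γ s → p ∈ γ '' s → (γ '' s ∩ S).Nonempty}

/-- A Cauchy hypersurface: a closed achronal set whose domain of dependence is all of `M`. -/
def IsCauchyHypersurface (S : Set M) : Prop :=
  IsClosed S ∧ g.IsAchronal S ∧ g.futureDomain S ∪ g.pastDomain S = univ

/-- Global hyperbolicity: there is a Cauchy hypersurface. -/
def GloballyHyperbolic : Prop := ∃ S : Set M, g.IsCauchyHypersurface S

/-! ### The volume measure -/

/-- The density `√|det (g(∂ᵢ, ∂ⱼ))|` in the chart `chartAt E4 c`, at the coordinate point `z`; here
`∂ᵢ` is the image of the `i`-th standard basis vector under the derivative of the inverse chart. -/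
def volumeDensity (c : M) (z : E4) : ℝ :=
  √|(Matrix.of fun i j : Fin 4 ↦
    g.metric ((chartAt E4 c).symm z)
      (mfderiv 𝓘(ℝ, E4) (𝓡 4) (chartAt E4 c).symm z (EuclideanSpace.single i (1 : ℝ)))
      (mfderiv 𝓘(ℝ, E4) (𝓡 4) (chartAt E4 c).symm z (EuclideanSpace.single j (1 : ℝ)))).det|

/-- The volume measure `√|det g| dx` on the domain of the chart `chartAt E4 c`. -/
def chartVolume [MeasurableSpace M] (c : M) : Measure M :=
  Measure.map (chartAt E4 c).symm
    ((volume.restrict (chartAt E4 c).target).withDensity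
      fun z ↦ ENNReal.ofReal (g.volumeDensity c z))

end Spacetime

variable (M) in
/-- A smooth partition of unity subordinate to the cover of `M` by the domains of its charts. -/
def chartPartition [T2Space M] [SecondCountableTopology M] :
    SmoothPartitionOfUnity M (𝓡 4) M univ :=
  haveI : LocallyCompactSpace M := Manifold.locallyCompact_of_finiteDimensional (𝓡 4)
  (SmoothPartitionOfUnity.exists_isSubordinate_chartAt_source (𝓡 4) M).choose

/-- The volume measure of `(M, g)`: the chart volumes are patched together by a partition of unity,
so that `∫ f = ∑_c ∫ ρ_c f √|det g| dx`. (It does not depend on the partition of unity.) -/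
def Spacetime.volumeMeasure [T2Space M] [SecondCountableTopology M] [MeasurableSpace M]
    (g : Spacetime M) : Measure M :=
  Measure.sum fun c : M ↦
    (g.chartVolume c).withDensity fun x ↦ ENNReal.ofReal (chartPartition M c x)

end Geometry

/-! ### Vector bundles, sections, differential operators -/

section Bundles

variable {M : Type*} [TopologicalSpace M] [ChartedSpace E4 M]
  {F : Type*} [NormedAddCommGroup F] [NormedSpace ℝ F]
  {E : M → Type*} [TopologicalSpace (TotalSpace F E)] [∀ x, TopologicalSpace (E x)]
  [∀ x, AddCommGroup (E x)] [∀ x, Module ℝ (E x)]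
  [FiberBundle F E] [VectorBundle ℝ F E]

variable (M F E) in
/-- `Γ(M,E)`: the real vector space of smooth sections. -/
abbrev Sections : Type _ := Cₛ^∞⟮𝓡 4; F, E⟯

variable (F E) in
/-- A Bosonic (symmetric) or Fermionic (antisymmetric) non-degenerate bilinear form on `E`,
depending smoothly on the base point. -/
structure BilinearForm [∀ x, IsTopologicalAddGroup (E x)] [∀ x, ContinuousSMul ℝ (E x)] where
  /-- The bilinear form on the fibres. -/
  form : ∀ x : M, E x →L[ℝ] E x →L[ℝ] ℝ
  contMDiff_form : ContMDiff (𝓡 4) ((𝓡 4).prod 𝓘(ℝ, F →L[ℝ] F →L[ℝ] ℝ)) ∞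
    (fun x ↦ TotalSpace.mk' (F →L[ℝ] F →L[ℝ] ℝ)
      (E := fun x : M ↦ E x →L[ℝ] E x →L[ℝ] ℝ) x (form x))
  bosonic_or_fermionic : (∀ (x : M) (v w : E x), form x v w = form x w v) ∨
    (∀ (x : M) (v w : E x), form x v w = -form x w v)
  nondegenerate : ∀ (x : M) (v : E x), (∀ w : E x, form x v w = 0) → v = 0

/-- The support of a section. -/
def supp (σ : Sections M F E) : Set M := closure {x | σ x ≠ 0}

lemma supp_zero : supp (0 : Sections M F E) = ∅ := by
  simp [supp]

lemma supp_add_subset (σ τ : Sections M F E) : supp (σ + τ) ⊆ supp σ ∪ supp τ := by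
  unfold supp
  rw [← closure_union]
  refine closure_mono fun x hx ↦ ?_
  by_contra h
  simp only [mem_union, mem_ofPred_eq, not_or, not_not] at h
  exact hx (by simp [h.1, h.2])

lemma supp_smul_subset (c : ℝ) (σ : Sections M F E) : supp (c • σ) ⊆ supp σ := by
  refine closure_mono fun x hx h ↦ hx (by simp [h])

variable (M F E) in
/-- `Γ₀(M,E)`: the smooth sections with compact support. -/
def compactSections : Submodule ℝ (Sections M F E) where
  carrier := {σ | IsCompact (supp σ)}
  zero_mem' := by simp [supp_zero]
  add_mem' {σ τ} hσ hτ :=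
    (hσ.union hτ).of_isClosed_subset isClosed_closure (supp_add_subset σ τ)
  smul_mem' c σ hσ := IsCompact.of_isClosed_subset hσ isClosed_closure (supp_smul_subset c σ)

/-- `L` is a linear partial differential operator of order at most `k`: around each point there are
a chart `φ` and a local trivialization `e` in which `L` reads
`∑_{i ≤ k} ∑_{j₁,…,jᵢ} A_{j₁…jᵢ} ∂_{j₁} ⋯ ∂_{jᵢ}` with smooth coefficients. -/
def IsDiffOpOfOrderAtMost (k : ℕ) (L : Sections M F E →ₗ[ℝ] Sections M F E) : Prop :=
  ∀ x : M, ∃ U : Set M, IsOpen U ∧ x ∈ U ∧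
    ∃ φ ∈ IsManifold.maximalAtlas (𝓡 4) ∞ M, U ⊆ φ.source ∧
    ∃ e : Trivialization F (TotalSpace.proj : TotalSpace F E → M),
      MemTrivializationAtlas e ∧ U ⊆ e.baseSet ∧
    ∃ A : (i : ℕ) → (Fin i → Fin 4) → E4 → (F →L[ℝ] F),
      (∀ i ≤ k, ∀ j, ContDiffOn ℝ ∞ (A i j) (φ '' U)) ∧
      ∀ σ : Sections M F E, ∀ y ∈ U,
        (e ⟨y, L σ y⟩).2 = ∑ i ∈ Finset.range (k + 1), ∑ j : Fin i → Fin 4,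
          A i j (φ y) (iteratedFDeriv ℝ i (fun z : E4 ↦ (e ⟨φ.symm z, σ (φ.symm z)⟩).2) (φ y)
            fun l ↦ EuclideanSpace.single (j l) (1 : ℝ))

variable (M F E) in
/-- A linear partial differential operator `Γ(M,E) → Γ(M,E)` (of some finite order). -/
structure DiffOp where
  /-- The underlying linear map. -/
  toLinearMap : Sections M F E →ₗ[ℝ] Sections M F E
  isDiffOp : ∃ k : ℕ, IsDiffOpOfOrderAtMost k toLinearMap

instance : CoeFun (DiffOp M F E) fun _ ↦ Sections M F E → Sections M F E :=
  ⟨fun P ↦ P.toLinearMap⟩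

/-- Differential operators do not enlarge supports. -/
lemma DiffOp.supp_subset (P : DiffOp M F E) (σ : Sections M F E) : supp (P σ) ⊆ supp σ := by
  obtain ⟨k, hk⟩ := P.isDiffOp
  refine closure_minimal (fun x hx ↦ ?_) isClosed_closure
  by_contra hxs
  apply hx
  obtain ⟨U, -, hxU, φ, -, hUφ, e, he, hUe, A, -, hA⟩ := hk x
  have hz : (fun z : E4 ↦ (e ⟨φ.symm z, σ (φ.symm z)⟩).2) =ᶠ[𝓝 (φ x)] fun _ ↦ (0 : F) := by
    have h1 : ∀ᶠ y in 𝓝 x, σ y = 0 ∧ y ∈ e.baseSet := by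
      refine Filter.Eventually.and ?_ (e.open_baseSet.mem_nhds (hUe hxU))
      filter_upwards [isClosed_closure.isOpen_compl.mem_nhds hxs] with y hy
      by_contra h
      exact hy (subset_closure h)
    have h2 := φ.symm.continuousAt (φ.map_source (hUφ hxU))
    rw [ContinuousAt, φ.left_inv (hUφ hxU)] at h2
    filter_upwards [h2.eventually h1] with z hz
    rw [hz.1]
    exact (e.linear ℝ hz.2).map_zero
  have h0 : (e ⟨x, P σ x⟩).2 = 0 := by
    rw [hA σ x hxU]
    refine Finset.sum_eq_zero fun i _ ↦ Finset.sum_eq_zero fun j _ ↦ ?_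
    have h3 := (hz.iteratedFDeriv ℝ i).eq_of_nhds
    have h4 : iteratedFDeriv ℝ i (fun _ : E4 ↦ (0 : F)) (φ x) = 0 := by
      simp
    rw [h3, h4]
    simp
  have h6 : (e.continuousLinearEquivAt ℝ x (hUe hxU)) (P σ x) = 0 := h0
  exact (ContinuousLinearEquiv.map_eq_zero_iff _).mp h6

/-- A differential operator, restricted to `Γ₀(M,E)`. -/
def DiffOp.onCompact (P : DiffOp M F E) : compactSections M F E →ₗ[ℝ] compactSections M F E :=
  P.toLinearMap.restrict fun σ hσ ↦
    IsCompact.of_isClosed_subset hσ isClosed_closure (P.supp_subset σ)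

end Bundles

/-! ### Green operators -/

section Green

variable {M : Type*} [TopologicalSpace M] [ChartedSpace E4 M] [IsManifold (𝓡 4) ∞ M]
  {F : Type*} [NormedAddCommGroup F] [NormedSpace ℝ F]
  {E : M → Type*} [TopologicalSpace (TotalSpace F E)] [∀ x, TopologicalSpace (E x)]
  [∀ x, AddCommGroup (E x)] [∀ x, Module ℝ (E x)]
  [FiberBundle F E] [VectorBundle ℝ F E]

/-- The pairing `(σ, τ) = ∫_M ⟨σ, τ⟩ vol_M` of sections. -/
def pairing [T2Space M] [SecondCountableTopology M] [MeasurableSpace M]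
    [∀ x, IsTopologicalAddGroup (E x)] [∀ x, ContinuousSMul ℝ (E x)]
    (g : Spacetime M) (b : BilinearForm F E) (σ τ : Sections M F E) : ℝ :=
  ∫ x, b.form x (σ x) (τ x) ∂g.volumeMeasure

/-- `Q` is the formal adjoint of `P`. -/
def IsFormalAdjoint [T2Space M] [SecondCountableTopology M] [MeasurableSpace M]
    [∀ x, IsTopologicalAddGroup (E x)] [∀ x, ContinuousSMul ℝ (E x)]
    (g : Spacetime M) (b : BilinearForm F E) (P Q : DiffOp M F E) : Prop :=
  ∀ u v : Sections M F E, IsCompact (supp u ∩ supp v) →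
    pairing g b (Q u) v = pairing g b u (P v)

/-- `G` is a Green operator for `P`, relative to a support map `J`. -/
structure IsGreenOperator (J : Set M → Set M) (P : DiffOp M F E)
    (G : compactSections M F E →ₗ[ℝ] Sections M F E) : Prop where
  right_inv : ∀ f : compactSections M F E, P (G f) = f
  left_inv : ∀ f : compactSections M F E, G (P.onCompact f) = f
  supp_subset : ∀ f : compactSections M F E, supp (G f) ⊆ J (supp (f : Sections M F E))

variable (g : Spacetime M)

/-- `G` is an advanced Green operator `G⁺` for `P` (supports propagate to the causal future). -/
def IsAdvancedGreen (P : DiffOp M F E) (G : compactSections M F E →ₗ[ℝ] Sections M F E) : Prop :=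
  IsGreenOperator g.causalFuture P G

/-- `G` is a retarded Green operator `G⁻` for `P` (supports propagate to the causal past). -/
def IsRetardedGreen (P : DiffOp M F E) (G : compactSections M F E →ₗ[ℝ] Sections M F E) : Prop :=
  IsGreenOperator g.causalPast P G

/-- `P` is Green-hyperbolic: it admits advanced and retarded Green operators. -/
def GreenHyperbolic (P : DiffOp M F E) : Prop :=
  (∃ G, IsAdvancedGreen g P G) ∧ ∃ G, IsRetardedGreen g P G

/-- `G = G⁺ - G⁻` is a causal propagator for `P`. -/
def IsCausalPropagator (P : DiffOp M F E) (G : compactSections M F E →ₗ[ℝ] Sections M F E) :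
    Prop :=
  ∃ Gp Gm, IsAdvancedGreen g P Gp ∧ IsRetardedGreen g P Gm ∧ G = Gp - Gm

/-- `𝒮_sc(M)`: the solutions of `P u = 0` whose support is contained in `J(K)` for some compact
set `K`. -/
def solutionsSC (P : DiffOp M F E) : Submodule ℝ (Sections M F E) where
  carrier := {u | P u = 0 ∧ ∃ K : Set M, IsCompact K ∧ supp u ⊆ g.causalHull K}
  zero_mem' := ⟨map_zero _, ∅, isCompact_empty, by simp [supp_zero]⟩
  add_mem' := by
    rintro u v ⟨hu, K, hK, huK⟩ ⟨hv, L, hL, hvL⟩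
    refine ⟨by rw [map_add, hu, hv, add_zero], K ∪ L, hK.union hL, ?_⟩
    refine (supp_add_subset u v).trans (union_subset ?_ ?_)
    · rintro x hx
      rcases huK hx with ⟨p, hp, h⟩ | ⟨p, hp, h⟩
      exacts [Or.inl ⟨p, Or.inl hp, h⟩, Or.inr ⟨p, Or.inl hp, h⟩]
    · rintro x hx
      rcases hvL hx with ⟨p, hp, h⟩ | ⟨p, hp, h⟩
      exacts [Or.inl ⟨p, Or.inr hp, h⟩, Or.inr ⟨p, Or.inr hp, h⟩]
  smul_mem' := by
    rintro c u ⟨hu, K, hK, huK⟩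
    exact ⟨by rw [map_smul, hu, smul_zero], K, hK, (supp_smul_subset c u).trans huK⟩

end Green

end QFTCurved

end

/-! Analytic half. Let H be the retarded Green operator of P*. If supp(Hσ) ∩ supp(u) is compact,
then (σ, u) = (P*Hσ, u) = (Hσ, Pu); since the pairing separates sections (`eq_of_pairing_eq`), Pu
determines u among sections supported in J⁺ of a compact set, and dually for J⁻. This makes G⁺ and
G⁻ unique. If Gf = 0, then G⁺f = G⁻f is supported in J⁺(supp f) ∩ J⁻(supp f), hence compactly, and f
= P(G⁺f) (`IsCausalPropagator.ker_eq`). For surjectivity, a solution u is cut into v + w, supported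
towards the future and the past with compact overlap (`exists_causal_splitting`). Then f = Pv = -Pw
has compact support, and uniqueness gives G⁺f = v and G⁻f = -w, so Gf = u.

Geometric half. All compactness comes from one fact: for a Cauchy hypersurface S and compact K, the
set J⁺(K) \ I⁺(S) lies in a compact set (`IsCauchyHypersurface.exists_compact_future`). With its
time reversal and I⁺(S) ∩ I⁻(S) = ∅ it bounds causal diamonds. The proof replaces limit curves by
limit points: along an ultrafilter that escapes to infinity inside J⁺(K), causal curves from K have
successive limit points whose chronological pasts increase. A timelike curve threaded just below
them is inextensible, so it meets S, and this puts the ultrafilter in I⁺(S). Closedness of J⁺(K) is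
never used.

The local tool (`exists_local_shift`) is a small map towards the past under which causal curves
become timelike. It yields the behaviour of pasts under limits and the push-up property. -/

namespace QFTCurved

/-! ### Piecewise smooth curves: transport, reparametrization, gluing. -/

section Curves

variable {M : Type*} [TopologicalSpace M] [ChartedSpace E4 M]
  {C C' : ∀ x : M, TangentSpace (𝓡 4) x → Prop} {γ : ℝ → M} {s : Set ℝ}

lemma IsPiecewiseSmoothCurve.mono_cone (h : IsPiecewiseSmoothCurve C γ s)
    (hC : ∀ x v, C x v → C' x v) : IsPiecewiseSmoothCurve C' γ s := by
  obtain ⟨hc, B, hB, H⟩ := h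
  exact ⟨hc, B, hB, fun a b hab hs hd ↦
    ⟨(H a b hab hs hd).1, fun t ht ↦ hC _ _ ((H a b hab hs hd).2 t ht)⟩⟩

lemma IsPiecewiseSmoothCurve.mono_set (h : IsPiecewiseSmoothCurve C γ s) {t : Set ℝ}
    (ht : t ⊆ s) : IsPiecewiseSmoothCurve C γ t := by
  obtain ⟨hc, B, hB, H⟩ := h
  exact ⟨hc.mono ht, B, fun a b hab ↦ hB a b (hab.trans ht),
    fun a b hab hs hd ↦ H a b hab (hs.trans ht) hd⟩

lemma uniqueMDiffWithinAt_Icc {a b t : ℝ} (hab : a < b) (ht : t ∈ Icc a b) :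
    UniqueMDiffWithinAt 𝓘(ℝ, ℝ) (Icc a b) t :=
  (uniqueDiffOn_Icc hab t ht).uniqueMDiffWithinAt

/-- Composition with a smooth map that maps one cone field to another. -/
lemma IsPiecewiseSmoothCurve.comp_left {N : Type*} [TopologicalSpace N] [ChartedSpace E4 N]
    {C' : ∀ x : N, TangentSpace (𝓡 4) x → Prop} (h : IsPiecewiseSmoothCurve C γ s) {Ψ : M → N} {W : Set M}
    (hW : IsOpen W) (hΨ : ContMDiffOn (𝓡 4) (𝓡 4) ∞ Ψ W)
    (hC : ∀ x ∈ W, ∀ v, C x v → C' (Ψ x) (mfderiv (𝓡 4) (𝓡 4) Ψ x v))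
    (hs : MapsTo γ s W) : IsPiecewiseSmoothCurve C' (Ψ ∘ γ) s := by
  obtain ⟨hc, B, hB, H⟩ := h
  refine ⟨hΨ.continuousOn.comp hc hs, B, hB, fun a b hab hsub hd ↦ ?_⟩
  obtain ⟨h1, h2⟩ := H a b hab hsub hd
  refine ⟨hΨ.comp h1 fun t ht ↦ hs (hsub ht), fun t ht ↦ ?_⟩
  have hx : γ t ∈ W := hs (hsub ht)
  have e : mfderivWithin 𝓘(ℝ, ℝ) (𝓡 4) (Ψ ∘ γ) (Icc a b) t =
      (mfderiv (𝓡 4) (𝓡 4) Ψ (γ t)).comp (mfderivWithin 𝓘(ℝ, ℝ) (𝓡 4) γ (Icc a b) t) :=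
    mfderiv_comp_mfderivWithin t (((hΨ _ hx).contMDiffAt (hW.mem_nhds hx)).mdifferentiableAt
      (by simp)) ((h1 t ht).mdifferentiableWithinAt (by simp)) (uniqueMDiffWithinAt_Icc hab ht)
  rw [e]
  exact hC _ hx _ (h2 t ht)

/-- Affine reparametrization. -/
lemma IsPiecewiseSmoothCurve.comp_affine (h : IsPiecewiseSmoothCurve C γ s) {α : ℝ} (hα : α ≠ 0)
    (β : ℝ) (hC : ∀ x v, C x v → C' x (α • v)) :
    IsPiecewiseSmoothCurve C' (fun t ↦ γ (α * t + β)) ((fun t ↦ α * t + β) ⁻¹' s) := by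
  obtain ⟨hc, B, hB, H⟩ := h
  have hinj : Function.Injective (fun t : ℝ ↦ α * t + β) := fun x y hxy ↦ by
    simpa [hα] using hxy
  have hsm : ContDiff ℝ ∞ (fun t : ℝ ↦ α * t + β) := by fun_prop
  -- the image of an interval
  have himg : ∀ a b : ℝ, a < b → ∃ a' b' : ℝ, a' < b' ∧
      (fun t : ℝ ↦ α * t + β) ⁻¹' Icc a' b' = Icc a b ∧
      (fun t : ℝ ↦ α * t + β) '' Icc a b = Icc a' b' ∧
      (fun t : ℝ ↦ α * t + β) '' Ioo a b = Ioo a' b' := by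
    intro a b hab
    -- For α < 0 the end points swap; α = -1 is the case behind time reversal.
    rcases lt_or_gt_of_ne hα with hn | hp
    · refine ⟨α * b + β, α * a + β, by nlinarith, ?_, ?_, ?_⟩
      · ext t
        simp only [mem_preimage, mem_Icc, add_le_add_iff_right, mul_le_mul_left_of_neg hn]
        tauto
      · ext t
        simp only [mem_image, mem_Icc]
        constructor
        · rintro ⟨x, ⟨h1, h2⟩, rfl⟩
          constructor <;> nlinarith
        · rintro ⟨h1, h2⟩
          refine ⟨(t - β) / α, ⟨?_, ?_⟩, by field_simp; ring⟩
          · rw [le_div_iff_of_neg hn]; linarith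
          · rw [div_le_iff_of_neg hn]; linarith
      · ext t
        simp only [mem_image, mem_Ioo]
        constructor
        · rintro ⟨x, ⟨h1, h2⟩, rfl⟩
          constructor <;> nlinarith
        · rintro ⟨h1, h2⟩
          refine ⟨(t - β) / α, ⟨?_, ?_⟩, by field_simp; ring⟩
          · rw [lt_div_iff_of_neg hn]; linarith
          · rw [div_lt_iff_of_neg hn]; linarith
    · refine ⟨α * a + β, α * b + β, by nlinarith, ?_, ?_, ?_⟩
      · ext t
        simp only [mem_preimage, mem_Icc, add_le_add_iff_right, mul_le_mul_iff_right₀ hp]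
      · ext t
        simp only [mem_image, mem_Icc]
        constructor
        · rintro ⟨x, ⟨h1, h2⟩, rfl⟩
          constructor <;> nlinarith
        · rintro ⟨h1, h2⟩
          refine ⟨(t - β) / α, ⟨?_, ?_⟩, by field_simp; ring⟩
          · rw [le_div_iff₀ hp]; linarith
          · rw [div_le_iff₀ hp]; linarith
      · ext t
        simp only [mem_image, mem_Ioo]
        constructor
        · rintro ⟨x, ⟨h1, h2⟩, rfl⟩
          constructor <;> nlinarith
        · rintro ⟨h1, h2⟩
          refine ⟨(t - β) / α, ⟨?_, ?_⟩, by field_simp; ring⟩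
          · rw [lt_div_iff₀ hp]; linarith
          · rw [div_lt_iff₀ hp]; linarith
  refine ⟨hc.comp hsm.continuous.continuousOn (mapsTo_preimage _ _),
    (fun t ↦ α * t + β) ⁻¹' B, fun a b hab ↦ ?_, fun a b hab hsub hd ↦ ?_⟩
  · rcases lt_or_ge a b with h | h
    · obtain ⟨a', b', -, h1, h2, -⟩ := himg a b h
      have := hB a' b' (by rw [← h2]; exact image_subset_iff.2 hab)
      rw [← h1, ← preimage_inter]
      exact this.preimage hinj.injOn
    · exact (subsingleton_Icc_of_ge h).finite.subset inter_subset_right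
  · obtain ⟨a', b', hab', h1, h2, h3⟩ := himg a b hab
    obtain ⟨k1, k2⟩ := H a' b' hab' (by rw [← h2]; exact image_subset_iff.2 hsub) (by
      rw [← h3, disjoint_image_left]; exact hd)
    have hm : MapsTo (fun t : ℝ ↦ α * t + β) (Icc a b) (Icc a' b') := by
      rw [← h1]; exact mapsTo_preimage _ _
    refine ⟨k1.comp hsm.contMDiff.contMDiffOn hm, fun t ht ↦ ?_⟩
    have hd : HasMFDerivWithinAt 𝓘(ℝ, ℝ) 𝓘(ℝ, ℝ) (fun t : ℝ ↦ α * t + β) (Icc a b) t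
        (ContinuousLinearMap.toSpanSingleton ℝ α) := by
      have : HasDerivWithinAt (fun t : ℝ ↦ α * t + β) α (Icc a b) t := by
        simpa using ((hasDerivAt_id t).const_mul α |>.add_const β).hasDerivWithinAt
      exact this.hasFDerivWithinAt.hasMFDerivWithinAt
    have hg := ((k1 _ (hm ht)).mdifferentiableWithinAt (by simp)).hasMFDerivWithinAt
    have hcomp := HasMFDerivWithinAt.comp t hg hd
      (show Icc a b ⊆ (fun t : ℝ ↦ α * t + β) ⁻¹' Icc a' b' from hm)
    have e := hcomp.mfderivWithin (uniqueMDiffWithinAt_Icc hab ht)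
    have key := hC _ _ (k2 _ (hm ht))
    have e2 : mfderivWithin 𝓘(ℝ, ℝ) (𝓡 4) (fun t ↦ γ (α * t + β)) (Icc a b) t (1 : ℝ) =
        α • mfderivWithin 𝓘(ℝ, ℝ) (𝓡 4) γ (Icc a' b') (α * t + β) (1 : ℝ) := by
      let A : ℝ →L[ℝ] TangentSpace (𝓡 4) (γ (α * t + β)) :=
        mfderivWithin 𝓘(ℝ, ℝ) (𝓡 4) γ (Icc a' b') (α * t + β)
      have e3 : A (α • (1 : ℝ)) = α • A 1 := A.map_smul α 1
      rw [← ContinuousLinearMap.toSpanSingleton_apply ℝ (1 : ℝ) α] at e3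
      have e4 : (ContinuousLinearMap.toSpanSingleton ℝ (1 : ℝ)) α =
        (ContinuousLinearMap.toSpanSingleton ℝ α) (1 : ℝ) := by simp
      rw [e4] at e3
      exact (DFunLike.congr_fun e (1 : ℝ)).trans e3
    rw [e2]
    exact key

lemma IsPiecewiseSmoothCurve.congr {γ' : ℝ → M} (h : IsPiecewiseSmoothCurve C γ s)
    (he : EqOn γ' γ s) : IsPiecewiseSmoothCurve C γ' s := by
  obtain ⟨hc, B, hB, H⟩ := h
  refine ⟨hc.congr he, B, hB, fun a b hab hs hd ↦ ?_⟩
  obtain ⟨h1, h2⟩ := H a b hab hs hd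
  refine ⟨h1.congr fun t ht ↦ he (hs ht), fun t ht ↦ ?_⟩
  have e := mfderivWithin_congr (I := 𝓘(ℝ, ℝ)) (I' := 𝓡 4) (fun t ht ↦ he (hs ht))
    (he (hs ht)) 
  have h2t := h2 t ht
  have e3 : γ' t = γ t := he (hs ht)
  rw [e]
  clear e
  revert h2t
  generalize mfderivWithin 𝓘(ℝ, ℝ) (𝓡 4) γ (Icc a b) t = A
  revert A
  rw [e3]
  exact fun A h ↦ h

/-- Gluing of curves along a locally finite family of intervals. -/
lemma isPiecewiseSmoothCurve_of_pieces {ι : Type*} {l r : ι → ℝ} {D : Set ℝ}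
    (hc : ContinuousOn γ s)
    (hD : ∀ a b, Icc a b ⊆ s → (D ∩ Icc a b).Finite)
    (hfin : ∀ a b, Icc a b ⊆ s → {i | (Icc (l i) (r i) ∩ Icc a b).Nonempty}.Finite)
    (hcov : ∀ a b, a < b → Icc a b ⊆ s → Disjoint (Ioo a b) D →
      ∃ i, Icc a b ⊆ Icc (l i) (r i))
    (h : ∀ i, IsPiecewiseSmoothCurve C γ (Icc (l i) (r i))) :
    IsPiecewiseSmoothCurve C γ s := by
  choose hci B hB H using h
  -- `B i` is controlled only inside its own interval, hence the intersection.
  refine ⟨hc, D ∪ ⋃ i, B i ∩ Icc (l i) (r i), fun a b hab ↦ ?_, fun a b hab hs hd ↦ ?_⟩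
  · rw [union_inter_distrib_right]
    refine (hD a b hab).union (((hfin a b hab).biUnion (t := fun i ↦ B i ∩ Icc (l i) (r i))
      fun i _ ↦ hB i _ _ subset_rfl).subset ?_)
    rintro t ⟨ht, htab⟩
    obtain ⟨i, hi⟩ := mem_iUnion.1 ht
    exact mem_biUnion (show i ∈ {i | (Icc (l i) (r i) ∩ Icc a b).Nonempty} from
      ⟨t, hi.2, htab⟩) hi
  · rw [disjoint_union_right] at hd
    obtain ⟨i, hi⟩ := hcov a b hab hs hd.1
    refine H i a b hab hi (disjoint_left.2 fun t ht htB ↦ ?_)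
    exact disjoint_left.1 hd.2 ht (mem_iUnion.2 ⟨i, htB, hi (Ioo_subset_Icc_self ht)⟩)

lemma IsPiecewiseSmoothCurve.union {a b c : ℝ} (hab : a ≤ b) (hbc : b ≤ c)
    (h1 : IsPiecewiseSmoothCurve C γ (Icc a b)) (h2 : IsPiecewiseSmoothCurve C γ (Icc b c)) :
    IsPiecewiseSmoothCurve C γ (Icc a c) := by
  refine isPiecewiseSmoothCurve_of_pieces (ι := Bool) (l := fun i ↦ bif i then a else b)
    (r := fun i ↦ bif i then b else c) (D := {b}) ?_ ?_ (fun _ _ _ ↦ toFinite _) ?_ ?_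
  · rw [← Icc_union_Icc_eq_Icc hab hbc]
    exact h1.1.union_of_isClosed h2.1 isClosed_Icc isClosed_Icc
  · exact fun _ _ _ ↦ (finite_singleton b).subset inter_subset_left
  · intro x y hxy hs hd
    have hx := hs (left_mem_Icc.2 hxy.le)
    have hy := hs (right_mem_Icc.2 hxy.le)
    have hb : b ∉ Ioo x y := by simpa using hd
    rcases le_or_gt b x with h | h
    · exact ⟨false, Icc_subset_Icc h hy.2⟩
    · exact ⟨true, Icc_subset_Icc hx.1 (not_lt.1 fun h' ↦ hb ⟨h, h'⟩)⟩
  · rintro (_ | _)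
    exacts [h2, h1]

/-- The unit intervals between integers are locally finite and their joints are the integers. This
assembles doubly infinite curves. -/
lemma isPiecewiseSmoothCurve_univ
    (h : ∀ n : ℤ, IsPiecewiseSmoothCurve C γ (Icc (n : ℝ) (n + 1))) :
    IsPiecewiseSmoothCurve C γ univ := by
  have hlf : LocallyFinite fun n : ℤ ↦ Icc (n : ℝ) (n + 1) := by
    intro x
    refine ⟨Ioo (x - 1) (x + 1), Ioo_mem_nhds (by linarith) (by linarith), ?_⟩
    refine (finite_Icc (⌊x - 1⌋ - 1) ⌈x + 1⌉).subset ?_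
    rintro n ⟨t, ⟨h1, h2⟩, h3, h4⟩
    constructor
    · have : ((⌊x - 1⌋ : ℤ) : ℝ) ≤ x - 1 := Int.floor_le _
      have : ((⌊x - 1⌋ : ℤ) : ℝ) < n + 1 := by linarith
      have : ⌊x - 1⌋ < n + 1 := by exact_mod_cast this
      omega
    · have : x + 1 ≤ ((⌈x + 1⌉ : ℤ) : ℝ) := Int.le_ceil _
      have : (n : ℝ) < ((⌈x + 1⌉ : ℤ) : ℝ) := by linarith
      have : n < ⌈x + 1⌉ := by exact_mod_cast this
      omega
  have hfin (a b : ℝ) : {i : ℤ | (Icc (i : ℝ) (i + 1) ∩ Icc a b).Nonempty}.Finite :=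
    hlf.finite_nonempty_inter_compact isCompact_Icc
  refine isPiecewiseSmoothCurve_of_pieces (ι := ℤ) (l := fun n ↦ n) (r := fun n ↦ n + 1)
    (D := range ((↑) : ℤ → ℝ)) ?_ ?_ (fun a b _ ↦ hfin a b) ?_ h
  · refine (hlf.continuous ?_ (fun _ ↦ isClosed_Icc) fun n ↦ (h n).1).continuousOn
    exact eq_univ_of_forall fun x ↦ mem_iUnion.2 ⟨⌊x⌋, Int.floor_le x, (Int.lt_floor_add_one x).le⟩
  · intro a b _
    refine ((hfin a b).image ((↑) : ℤ → ℝ)).subset ?_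
    rintro _ ⟨⟨n, rfl⟩, hn⟩
    exact ⟨n, ⟨n, ⟨le_rfl, by linarith⟩, hn⟩, rfl⟩
  · intro a b hab _ hd
    refine ⟨⌊a⌋, Icc_subset_Icc (Int.floor_le a) (not_lt.1 fun h' ↦ ?_)⟩
    refine (Set.disjoint_left.1 hd : ∀ ⦃x : ℝ⦄, _) (⟨Int.lt_floor_add_one a, h'⟩ : (⌊a⌋ : ℝ) + 1 ∈ Ioo a b) ⟨⌊a⌋ + 1, ?_⟩
    push_cast
    rfl

end Curves

/-! ### Reachability by curves inside a given set. -/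

section Relations

variable {M : Type*} [TopologicalSpace M] [ChartedSpace E4 M]
  {C C' : ∀ x : M, TangentSpace (𝓡 4) x → Prop} {γ : ℝ → M}

/-- `q` can be reached from `p` by a piecewise smooth curve in `W` with tangent vectors in `C`. -/
def ReachableIn (C : ∀ x : M, TangentSpace (𝓡 4) x → Prop) (W : Set M) (p q : M) : Prop :=
  ∃ γ : ℝ → M, IsPiecewiseSmoothCurve C γ (Icc 0 1) ∧ γ 0 = p ∧ γ 1 = q ∧ MapsTo γ (Icc 0 1) W

lemma ReachableIn.mono {W W' : Set M} {p q : M} (h : ReachableIn C W p q) (hW : W ⊆ W') :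
    ReachableIn C W' p q := by
  obtain ⟨γ, h1, h2, h3, h4⟩ := h
  exact ⟨γ, h1, h2, h3, h4.mono_right hW⟩

lemma IsPiecewiseSmoothCurve.reachableIn {a b : ℝ} (hab : a < b)
    (h : IsPiecewiseSmoothCurve C γ (Icc a b))
    (hC : ∀ (α : ℝ), 0 < α → ∀ x v, C x v → C x (α • v)) :
    ReachableIn C (γ '' Icc a b) (γ a) (γ b) := by
  have hm : Icc (0 : ℝ) 1 ⊆ (fun t ↦ (b - a) * t + a) ⁻¹' Icc a b := by
    rintro t ⟨h0, h1⟩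
    constructor <;> nlinarith
  refine ⟨fun t ↦ γ ((b - a) * t + a), (h.comp_affine (sub_pos.2 hab).ne' a
    (hC _ (sub_pos.2 hab))).mono_set hm, by simp, by simp, fun t ht ↦ ⟨_, hm ht, rfl⟩⟩

lemma ReachableIn.trans {W : Set M} {p q r : M}
    (hC : ∀ (α : ℝ), 0 < α → ∀ x v, C x v → C x (α • v))
    (h1 : ReachableIn C W p q) (h2 : ReachableIn C W q r) : ReachableIn C W p r := by
  obtain ⟨γ, h, h0, h1, hW⟩ := h1
  obtain ⟨δ, k, k0, k1, kW⟩ := h2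
  -- The second curve is run over [1, 2]; the joined curve on [0, 2] is then rescaled to [0, 1].
  let ε : ℝ → M := fun t ↦ if t ≤ 1 then γ t else δ (1 * t + (-1))
  have e1 : IsPiecewiseSmoothCurve C ε (Icc 0 1) := h.congr fun t ht ↦ if_pos ht.2
  have e2 : IsPiecewiseSmoothCurve C ε (Icc 1 2) := by
    refine ((k.comp_affine one_ne_zero (-1) (hC _ one_pos)).mono_set ?_).congr ?_
    · rintro t ⟨h, h'⟩
      constructor <;> linarith
    · rintro t ⟨h, h'⟩
      by_cases ht : t ≤ 1
      · have : t = 1 := le_antisymm ht h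
        subst this
        simp [ε, h1, k0]
      · simp [ε, ht]
  have key := (e1.union zero_le_one one_le_two e2).reachableIn two_pos hC
  have z0 : ε 0 = p := by simp [ε, h0]
  have z1 : ε 2 = r := by
    have : (2 : ℝ) + -1 = 1 := by norm_num
    simp [ε, this, k1]
  rw [z0, z1] at key
  refine key.mono ?_
  rintro _ ⟨t, ht, rfl⟩
  by_cases h' : t ≤ 1
  · simpa [ε, h'] using hW ⟨ht.1, h'⟩
  · have : t + -1 ∈ Icc (0 : ℝ) 1 := ⟨by linarith, by linarith [ht.2]⟩
    simpa [ε, h'] using kW this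

lemma ReachableIn.reverse {W : Set M} {p q : M} (hC : ∀ x v, C x v → C' x (-v))
    (h : ReachableIn C W p q) : ReachableIn C' W q p := by
  obtain ⟨γ, h, h0, h1, hW⟩ := h
  have hm : Icc (0 : ℝ) 1 ⊆ (fun t ↦ (-1 : ℝ) * t + 1) ⁻¹' Icc 0 1 := by
    rintro t ⟨h0, h1⟩
    constructor <;> linarith
  refine ⟨fun t ↦ γ (-1 * t + 1), (h.comp_affine (by norm_num) 1 fun x v hv ↦ ?_).mono_set hm,
    by simp [h1], by simp [h0], fun t ht ↦ hW (hm ht)⟩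
  simpa using hC x v hv

end Relations

/-! ### Causal relations and time reversal. -/

namespace Spacetime

variable {M : Type*} [TopologicalSpace M] [ChartedSpace E4 M] [IsManifold (𝓡 4) ∞ M]
  (g : Spacetime M)

lemma futureCausal_smul (α : ℝ) (hα : 0 < α) (x : M) (v : TangentSpace (𝓡 4) x)
    (h : g.FutureCausal x v) : g.FutureCausal x (α • v) := by
  obtain ⟨h1, h2⟩ := h
  simp only [FutureCausal, map_smul, smul_apply, smul_eq_mul]
  exact ⟨mul_nonpos_of_nonneg_of_nonpos hα.le (mul_nonpos_of_nonneg_of_nonpos hα.le h1),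
    mul_neg_of_pos_of_neg hα h2⟩

lemma futureTimelike_smul (α : ℝ) (hα : 0 < α) (x : M) (v : TangentSpace (𝓡 4) x)
    (h : g.FutureTimelike x v) : g.FutureTimelike x (α • v) := by
  obtain ⟨h1, h2⟩ := h
  simp only [FutureTimelike, map_smul, smul_apply, smul_eq_mul]
  exact ⟨mul_neg_of_pos_of_neg hα (mul_neg_of_pos_of_neg hα h1), mul_neg_of_pos_of_neg hα h2⟩

variable {g}

lemma FutureTimelike.futureCausal {x : M} {v : TangentSpace (𝓡 4) x}
    (h : g.FutureTimelike x v) : g.FutureCausal x v := ⟨h.1.le, h.2⟩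

lemma chronologicallyPrecedes_iff {p q : M} :
    g.ChronologicallyPrecedes p q ↔ ReachableIn g.FutureTimelike univ p q := by
  simp [ChronologicallyPrecedes, ReachableIn]

lemma causallyPrecedes_iff {p q : M} :
    g.CausallyPrecedes p q ↔ p = q ∨ ReachableIn g.FutureCausal univ p q := by
  simp [CausallyPrecedes, ReachableIn]

lemma ChronologicallyPrecedes.trans {p q r : M} (h : g.ChronologicallyPrecedes p q)
    (h' : g.ChronologicallyPrecedes q r) : g.ChronologicallyPrecedes p r := by
  rw [chronologicallyPrecedes_iff] at *
  exact ReachableIn.trans g.futureTimelike_smul h h'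

lemma CausallyPrecedes.refl (p : M) : g.CausallyPrecedes p p := Or.inl rfl

variable (g) in
/-- The same metric with the opposite time orientation. -/
noncomputable def reverse : Spacetime M where
  metric := g.metric
  symm := g.symm
  signature := g.signature
  contMDiff_metric := g.contMDiff_metric
  timeField := fun x ↦ -g.timeField x
  contMDiff_timeField := ContMDiff.neg_section g.contMDiff_timeField
  timelike_timeField := fun x ↦ by
    simpa using g.timelike_timeField x

lemma reverse_futureCausal {x : M} {v : TangentSpace (𝓡 4) x} :
    g.reverse.FutureCausal x v ↔ g.FutureCausal x (-v) := by
  simp [FutureCausal, reverse]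

lemma reverse_futureTimelike {x : M} {v : TangentSpace (𝓡 4) x} :
    g.reverse.FutureTimelike x v ↔ g.FutureTimelike x (-v) := by
  simp [FutureTimelike, reverse]

lemma reverse_chronologicallyPrecedes {p q : M} :
    g.reverse.ChronologicallyPrecedes p q ↔ g.ChronologicallyPrecedes q p := by
  simp only [chronologicallyPrecedes_iff]
  exact ⟨ReachableIn.reverse fun x v h ↦ reverse_futureTimelike.1 h,
    ReachableIn.reverse fun x v h ↦ reverse_futureTimelike.2 (by simpa using h)⟩

lemma reverse_causallyPrecedes {p q : M} :
    g.reverse.CausallyPrecedes p q ↔ g.CausallyPrecedes q p := by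
  simp only [causallyPrecedes_iff]
  refine or_congr eq_comm ⟨ReachableIn.reverse fun x v h ↦ reverse_futureCausal.1 h,
    ReachableIn.reverse fun x v h ↦ reverse_futureCausal.2 (by simpa using h)⟩

lemma reverse_causalFuture (K : Set M) : g.reverse.causalFuture K = g.causalPast K := by
  simp [causalFuture, causalPast, reverse_causallyPrecedes]

variable (g) in
/-- The chronological past `I⁻(Ω)`. -/
def chronologicalPast (Ω : Set M) : Set M := {q | ∃ p ∈ Ω, g.ChronologicallyPrecedes q p}

lemma reverse_chronologicalFuture (K : Set M) :
    g.reverse.chronologicalFuture K = g.chronologicalPast K := by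
  simp [chronologicalFuture, chronologicalPast, reverse_chronologicallyPrecedes]

/-- A common point would lie on a timelike curve from one point of S to another. -/
lemma IsAchronal.disjoint {S : Set M} (hS : g.IsAchronal S) :
    Disjoint (g.chronologicalFuture S) (g.chronologicalPast S) := by
  rw [Set.disjoint_left]
  rintro x ⟨s, hs, h⟩ ⟨s', hs', h'⟩
  exact (eq_empty_iff_forall_notMem.1 hS) s' ⟨⟨s, hs, h.trans h'⟩, hs'⟩

lemma IsAchronal.reverse {S : Set M} (hS : g.IsAchronal S) : g.reverse.IsAchronal S := by
  rw [IsAchronal, reverse_chronologicalFuture, eq_empty_iff_forall_notMem]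
  rintro x ⟨⟨s, hs, h⟩, hx⟩
  exact (eq_empty_iff_forall_notMem.1 hS) s ⟨⟨x, hx, h⟩, hs⟩

lemma isPiecewiseSmoothCurve_reverse {γ : ℝ → M} {s : Set ℝ}
    (h : IsPiecewiseSmoothCurve g.reverse.FutureCausal γ s) :
    IsPiecewiseSmoothCurve g.FutureCausal (fun t ↦ γ (-t)) (Neg.neg ⁻¹' s) := by
  have := h.comp_affine (C' := g.FutureCausal) (α := -1) (by norm_num) 0 fun x v hv ↦ by
    simpa using reverse_futureCausal.1 hv
  simpa [Function.comp_def] using this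

/-- The substitution t ↦ -t keeps the image of a curve and exchanges past and future end points. -/
lemma futureDomain_subset_reverse (S : Set M) : g.futureDomain S ⊆ g.reverse.pastDomain S := by
  intro p hp γ s hs hγ hext hpγ
  have e : (fun t ↦ γ (-t)) '' (Neg.neg ⁻¹' s) = γ '' s := by
    ext x
    constructor
    · rintro ⟨t, ht, rfl⟩
      exact ⟨-t, ht, rfl⟩
    · rintro ⟨t, ht, rfl⟩
      exact ⟨-t, by simpa using ht, by simp⟩
  rw [← e]
  refine hp _ _ ?_ (isPiecewiseSmoothCurve_reverse hγ) ?_ (by rwa [e])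
  · refine ⟨fun x hx y hy z hz ↦ hs.out hy hx ⟨?_, ?_⟩⟩
    · exact neg_le_neg hz.2
    · exact neg_le_neg hz.1
  · rintro ⟨q, hq⟩
    refine hext ⟨q, fun U hU ↦ ?_⟩
    obtain ⟨t₀, ht₀, h⟩ := hq U hU
    refine ⟨-t₀, ht₀, fun t ht htt ↦ ?_⟩
    simpa using h (-t) (by simpa using ht) (by linarith)

lemma pastDomain_subset_reverse (S : Set M) : g.pastDomain S ⊆ g.reverse.futureDomain S := by
  intro p hp γ s hs hγ hext hpγ
  have e : (fun t ↦ γ (-t)) '' (Neg.neg ⁻¹' s) = γ '' s := by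
    ext x
    constructor
    · rintro ⟨t, ht, rfl⟩
      exact ⟨-t, ht, rfl⟩
    · rintro ⟨t, ht, rfl⟩
      exact ⟨-t, by simpa using ht, by simp⟩
  rw [← e]
  refine hp _ _ ?_ (isPiecewiseSmoothCurve_reverse hγ) ?_ (by rwa [e])
  · refine ⟨fun x hx y hy z hz ↦ hs.out hy hx ⟨?_, ?_⟩⟩
    · exact neg_le_neg hz.2
    · exact neg_le_neg hz.1
  · rintro ⟨q, hq⟩
    refine hext ⟨q, fun U hU ↦ ?_⟩
    obtain ⟨t₀, ht₀, h⟩ := hq U hU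
    refine ⟨-t₀, ht₀, fun t ht htt ↦ ?_⟩
    simpa using h (-t) (by simpa using ht) (by linarith)

lemma IsCauchyHypersurface.reverse {S : Set M} (hS : g.IsCauchyHypersurface S) :
    g.reverse.IsCauchyHypersurface S := by
  refine ⟨hS.1, hS.2.1.reverse, eq_univ_of_univ_subset ?_⟩
  rw [← hS.2.2, union_comm]
  exact union_subset_union (pastDomain_subset_reverse S) (futureDomain_subset_reverse S)

end Spacetime

end QFTCurved

/-! ### The metric and the time orientation in a chart. -/

namespace QFTCurved
namespace Spacetime
variable {M : Type*} [TopologicalSpace M] [ChartedSpace E4 M] [IsManifold (𝓡 4) ∞ M]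
  (g : Spacetime M) (c : M)

/-- The derivative of the inverse of the chart at `c`. -/
noncomputable def frame (c : M) (x : E4) : E4 →L[ℝ] TangentSpace (𝓡 4) ((chartAt E4 c).symm x) :=
  mfderiv 𝓘(ℝ, E4) (𝓡 4) (chartAt E4 c).symm x

/-- The metric in the coordinates of the chart at `c`. -/
noncomputable def coordMetric (x : E4) : E4 →L[ℝ] E4 →L[ℝ] ℝ :=
  let B : E4 →L[ℝ] E4 →L[ℝ] ℝ := g.metric ((chartAt E4 c).symm x)
  let D : E4 →L[ℝ] E4 := frame c x
  B.bilinearComp D D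

/-- The covector dual to the time orientation in the coordinates of the chart at `c`. -/
noncomputable def coordTime (x : E4) : E4 →L[ℝ] ℝ :=
  (g.metric ((chartAt E4 c).symm x) (g.timeField ((chartAt E4 c).symm x))).comp (frame c x)

/-- Constant coordinate fields give smooth fields on M; inserting them into the metric makes its
coordinate components smooth. -/
lemma contMDiffOn_frame (c : M) (v : E4) : ContMDiffOn 𝓘(ℝ, E4) (𝓡 4).tangent ∞
    (fun x ↦ (⟨(chartAt E4 c).symm x, frame c x v⟩ : TangentBundle (𝓡 4) M))
    (chartAt E4 c).target := by
  have h1 := contMDiffOn_chart_symm (I := 𝓡 4) (n := ∞) (x := c)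
  have hopen := (chartAt E4 c).open_target
  have h2 := h1.contMDiffOn_tangentMapWithin (m := ∞) (by simp) hopen.uniqueMDiffOn
  have h3 : ContMDiffOn (𝓡 4) (𝓡 4).tangent ∞
      (fun x : E4 ↦ (⟨x, v⟩ : TangentBundle (𝓡 4) E4)) (chartAt E4 c).target :=
    contMDiffOn_vectorSpace_iff_contDiffOn.2 contDiffOn_const
  refine (h2.comp h3 fun x hx ↦ hx).congr fun x hx ↦ ?_
  simp only [Function.comp, tangentMapWithin, frame]
  rw [mfderivWithin_of_isOpen hopen hx]
  rfl

lemma contDiffOn_coordMetric :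
    ContDiffOn ℝ ∞ (g.coordMetric c) (chartAt E4 c).target := by
  refine contDiffOn_clm_apply.2 fun v ↦ contDiffOn_clm_apply.2 fun w ↦ ?_
  have hb := contMDiffOn_chart_symm (I := 𝓡 4) (n := ∞) (x := c)
  have key := ContMDiffOn.clm_bundle_apply₂ (F₁ := E4) (F₂ := E4) (F₃ := ℝ)
    (E₁ := fun x : M ↦ TangentSpace (𝓡 4) x) (E₂ := fun x : M ↦ TangentSpace (𝓡 4) x)
    (E₃ := Bundle.Trivial M ℝ)
    (g.contMDiff_metric.comp_contMDiffOn hb) (contMDiffOn_frame c v) (contMDiffOn_frame c w)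
  exact (fun x hx ↦ ((contMDiffWithinAt_totalSpace).1 (key x hx)).2.contDiffWithinAt)

lemma contDiffOn_coordTime :
    ContDiffOn ℝ ∞ (g.coordTime c) (chartAt E4 c).target := by
  refine contDiffOn_clm_apply.2 fun v ↦ ?_
  have hb := contMDiffOn_chart_symm (I := 𝓡 4) (n := ∞) (x := c)
  have key := ContMDiffOn.clm_bundle_apply₂ (F₁ := E4) (F₂ := E4) (F₃ := ℝ)
    (E₁ := fun x : M ↦ TangentSpace (𝓡 4) x) (E₂ := fun x : M ↦ TangentSpace (𝓡 4) x)
    (E₃ := Bundle.Trivial M ℝ)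
    (g.contMDiff_metric.comp_contMDiffOn hb) (g.contMDiff_timeField.comp_contMDiffOn hb)
    (contMDiffOn_frame c v)
  exact (fun x hx ↦ ((contMDiffWithinAt_totalSpace).1 (key x hx)).2.contDiffWithinAt)
end Spacetime
-- Pushing a cone field into its interior.
section ConeShift

variable {V : Type*} [NormedAddCommGroup V] [NormedSpace ℝ V]

/-- If a timelike vector is orthogonal to no causal vector at `x₀`, then this holds uniformly
near `x₀`. -/
lemma exists_causal_lower_bound [FiniteDimensional ℝ V] {x₀ : V} {G : V → V →L[ℝ] V →L[ℝ] ℝ}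
    {τ : V → V →L[ℝ] ℝ} (hG : ContinuousAt G x₀) (hτ : ContinuousAt τ x₀)
    (hL : ∀ v, τ x₀ v = 0 → G x₀ v v ≤ 0 → v = 0) :
    ∃ κ > 0, ∀ᶠ x in 𝓝 x₀, ∀ v, G x v v ≤ 0 → κ * ‖v‖ ≤ |τ x v| := by
  have hK : IsCompact (Metric.sphere (0 : V) 1) := by
    have := FiniteDimensional.proper_real V
    exact isCompact_sphere 0 1
  -- A unit vector is either spacelike or not annihilated by τ. The maximum turns this into one
  -- positive continuous function on a compact sphere.
  have hpos : ∀ v ∈ Metric.sphere (0 : V) 1, 0 < max (G x₀ v v) |τ x₀ v| := by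
    intro v hv
    by_contra h
    simp only [not_lt, max_le_iff, abs_nonpos_iff] at h
    have := hL v h.2 h.1
    simp [this] at hv
  obtain ⟨κ, hκ, hκv⟩ := hK.exists_forall_le'
    ((((G x₀).continuous.clm_apply continuous_id).max (τ x₀).continuous.abs).continuousOn) hpos
  refine ⟨κ / 2, half_pos hκ, ?_⟩
  have hev : ∀ᶠ x in 𝓝 x₀, ∀ v ∈ Metric.sphere (0 : V) 1,
      κ / 2 < max (G x v v) |τ x v| := by
    refine hK.eventually_forall_of_forall_eventually fun v hv ↦ ?_
    have h1 : ContinuousAt (fun z : V × V ↦ G z.1) (x₀, v) :=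
      ContinuousAt.comp (f := Prod.fst) (x := (x₀, v)) hG continuousAt_fst
    have h2 : ContinuousAt (fun z : V × V ↦ τ z.1) (x₀, v) :=
      ContinuousAt.comp (f := Prod.fst) (x := (x₀, v)) hτ continuousAt_fst
    have h3 : ContinuousAt (fun z : V × V ↦ z.2) (x₀, v) := continuousAt_snd
    have h4 : ContinuousAt (fun z : V × V ↦ max (G z.1 z.2 z.2) |τ z.1 z.2|) (x₀, v) :=
      ((h1.clm_apply h3).clm_apply h3).max (h2.clm_apply h3).abs
    exact h4.eventually (lt_mem_nhds ((half_lt_self hκ).trans_le (hκv v hv)))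
  filter_upwards [hev] with x hx v hv
  rcases eq_or_ne v 0 with rfl | h0
  · simp
  have hn : 0 < ‖v‖ := norm_pos_iff.2 h0
  have := hx (‖v‖⁻¹ • v) (by simp [norm_smul, hn.ne'])
  simp only [map_smul, smul_apply, smul_eq_mul, lt_max_iff] at this
  rcases this with h | h
  · exfalso
    have : ‖v‖⁻¹ * (‖v‖⁻¹ * G x v v) ≤ 0 :=
      mul_nonpos_of_nonneg_of_nonpos (by positivity)
        (mul_nonpos_of_nonneg_of_nonpos (by positivity) hv)
    linarith
  · rw [abs_mul, abs_of_pos (inv_pos.2 hn), inv_mul_eq_div, lt_div_iff₀ hn] at h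
    exact h.le

/-- The map that shifts `x` by a multiple of `T` depending exponentially on the time
coordinate. -/
noncomputable def expShift (l : V →L[ℝ] ℝ) (T x₀ : V) (C ε : ℝ) (x : V) : V :=
  x - (ε * Real.exp (C * l (x - x₀))) • T

lemma contDiff_expShift (l : V →L[ℝ] ℝ) (T x₀ : V) (C ε : ℝ) :
    ContDiff ℝ ∞ (expShift l T x₀ C ε) := by
  unfold expShift
  fun_prop

lemma fderiv_expShift (l : V →L[ℝ] ℝ) (T x₀ : V) (C ε : ℝ) (x v : V) :
    fderiv ℝ (expShift l T x₀ C ε) x v =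
      v - (ε * Real.exp (C * l (x - x₀)) * (C * l v)) • T := by
  have h1 : HasFDerivAt (fun x : V ↦ C * l (x - x₀)) (C • l) x := by
    have := (l.hasFDerivAt (x := x - x₀)).comp x ((hasFDerivAt_id x).sub_const x₀)
    simpa using this.const_mul C
  have h2 := (h1.exp.const_mul ε).smul_const T
  have h3 : HasFDerivAt (expShift l T x₀ C ε) _ x := (hasFDerivAt_id x).sub h2
  rw [h3.fderiv]
  simp [mul_assoc]

set_option synthInstance.maxHeartbeats 200000 in
/-- Near a point, a cone field can be pushed into its interior by a small shift against the time
orientation. -/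
lemma exists_expShift [FiniteDimensional ℝ V] {U : Set V} (hU : IsOpen U) {x₀ : V} (hx₀ : x₀ ∈ U)
    {G : V → V →L[ℝ] V →L[ℝ] ℝ} {τ : V → V →L[ℝ] ℝ} (hG : ContDiffOn ℝ ∞ G U)
    (hτ : ContinuousOn τ U) (hsymm : ∀ x v w, G x v w = G x w v) {T : V}
    (hT : G x₀ T T < 0) (hτT : τ x₀ = G x₀ T) (hL : ∀ v, τ x₀ v = 0 → G x₀ v v ≤ 0 → v = 0) :
    ∃ W ⊆ U, IsOpen W ∧ x₀ ∈ W ∧ ∃ C : ℝ, ∃ ε₀ > 0, ∀ ε ∈ Ioo 0 ε₀, ∀ x ∈ W,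
      (∃ δ : ℝ, 0 < δ ∧ expShift (τ x₀) T x₀ C ε x = x - δ • T ∧
        ∀ s ∈ Icc (0 : ℝ) δ, x - s • T ∈ U ∧ G (x - s • T) T T < 0 ∧ τ (x - s • T) T < 0) ∧
      ∀ v, G x v v ≤ 0 → τ x v < 0 →
        G (expShift (τ x₀) T x₀ C ε x) (fderiv ℝ (expShift (τ x₀) T x₀ C ε) x v)
          (fderiv ℝ (expShift (τ x₀) T x₀ C ε) x v) < 0 ∧
        τ (expShift (τ x₀) T x₀ C ε x) (fderiv ℝ (expShift (τ x₀) T x₀ C ε) x v) < 0 := by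
  have hUn := hU.mem_nhds hx₀
  have hG1 : ContDiffAt ℝ 1 G x₀ := (hG.contDiffAt hUn).of_le (by simp)
  have hGc : ContinuousAt G x₀ := hG1.continuousAt
  have hτc : ContinuousAt τ x₀ := hτ.continuousAt hUn
  obtain ⟨κ, hκ, hκev⟩ := exists_causal_lower_bound hGc hτc hL
  obtain ⟨Λ, N, hN, hΛ⟩ := hG1.exists_lipschitzOnWith
  have hτ0T : τ x₀ T < 0 := by rw [hτT]; exact hT
  have ev1 : ∀ᶠ x in 𝓝 x₀, G x T T < 0 :=
    ((hGc.clm_apply continuousAt_const).clm_apply continuousAt_const).eventually (gt_mem_nhds hT)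
  have ev2 : ∀ᶠ x in 𝓝 x₀, τ x T < 0 :=
    (hτc.clm_apply continuousAt_const).eventually (gt_mem_nhds hτ0T)
  have ev3 : ∀ᶠ x in 𝓝 x₀, ‖τ x - τ x₀‖ < κ / 4 := by
    simpa [dist_eq_norm] using hτc.eventually (Metric.ball_mem_nhds _ (by positivity))
  have ev4 : ∀ᶠ x in 𝓝 x₀, ‖G x T - G x₀ T‖ < κ / 4 := by
    simpa [dist_eq_norm] using (hGc.clm_apply (continuousAt_const (y := T))).eventually
      (Metric.ball_mem_nhds _ (by positivity))
  obtain ⟨R, hR, hball⟩ := Metric.eventually_nhds_iff_ball.1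
    ((((((hκev.and ev1).and ev2).and ev3).and ev4).and hN).and hUn)
  set l := τ x₀ with hl
  -- Moving the base point by δT changes G v v by at most Λδ‖T‖‖v‖². The derivative adds δCqT to v
  -- with q ≥ κ‖v‖/2, and G T v ≤ -κ‖v‖/4, so the cross terms contribute at most -δCκ²‖v‖²/4 =
  -- -δ(Λ‖T‖ + 1)‖v‖². Gain and loss are both linear in δ, so C need not depend on ε.
  set C : ℝ := 4 * (Λ * ‖T‖ + 1) / κ ^ 2 with hC
  have hC0 : 0 < C := by positivity
  set Q : ℝ := Real.exp (C * (‖l‖ * R)) with hQ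
  have hQ0 : 0 < Q := Real.exp_pos _
  have hT1 : 0 < ‖T‖ + 1 := by positivity
  -- Q bounds the exponential on the ball of radius R. The bound on ε keeps the shift shorter than R
  -- / 2, so the segment from x to its image stays where all estimates hold.
  refine ⟨Metric.ball x₀ (R / 2), fun x hx ↦
    (hball x (Metric.ball_subset_ball (by linarith) hx)).2, Metric.isOpen_ball,
    Metric.mem_ball_self (by positivity), C, R / 2 / (Q * (‖T‖ + 1)), by positivity, ?_⟩
  rintro ε ⟨hε, hεb⟩ x hx
  set δ : ℝ := ε * Real.exp (C * l (x - x₀)) with hδ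
  have hδ0 : 0 < δ := by positivity
  have hxR : ‖x - x₀‖ < R / 2 := by simpa [dist_eq_norm] using hx
  have hδT : δ * ‖T‖ < R / 2 := by
    have h1 : C * l (x - x₀) ≤ C * (‖l‖ * R) := by
      refine mul_le_mul_of_nonneg_left ?_ hC0.le
      calc l (x - x₀) ≤ ‖l (x - x₀)‖ := Real.le_norm_self _
        _ ≤ ‖l‖ * ‖x - x₀‖ := l.le_opNorm _
        _ ≤ ‖l‖ * R := by gcongr; linarith
    have h2 : δ ≤ ε * Q := by
      exact mul_le_mul_of_nonneg_left (Real.exp_le_exp.2 h1) hε.le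
    rw [lt_div_iff₀ (by positivity)] at hεb
    calc δ * ‖T‖ ≤ (ε * Q) * (‖T‖ + 1) := by gcongr; linarith
      _ < R / 2 := by linarith
  have hseg : ∀ s ∈ Icc 0 δ, x - s • T ∈ Metric.ball x₀ R := by
    rintro s ⟨hs0, hs⟩
    rw [Metric.mem_ball, dist_eq_norm]
    calc ‖x - s • T - x₀‖ = ‖(x - x₀) - s • T‖ := by congr 1; abel
      _ ≤ ‖x - x₀‖ + ‖s • T‖ := norm_sub_le _ _
      _ = ‖x - x₀‖ + s * ‖T‖ := by rw [norm_smul, Real.norm_of_nonneg hs0]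
      _ ≤ ‖x - x₀‖ + δ * ‖T‖ := by gcongr
      _ < R := by linarith
  have hΦ : expShift l T x₀ C ε x = x - δ • T := rfl
  refine ⟨⟨δ, hδ0, hΦ, fun s hs ↦ ?_⟩, fun v hv hτv ↦ ?_⟩
  · obtain ⟨⟨⟨⟨⟨⟨-, h1⟩, h2⟩, -⟩, -⟩, -⟩, h3⟩ := hball _ (hseg s hs)
    exact ⟨h3, h1, h2⟩
  rw [fderiv_expShift, hΦ, ← hδ]
  obtain ⟨⟨⟨⟨⟨⟨hx1, -⟩, -⟩, hx3⟩, -⟩, hx5⟩, -⟩ :=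
    hball x (Metric.ball_subset_ball (by linarith) hx)
  obtain ⟨⟨⟨⟨⟨⟨-, hy1⟩, hy2⟩, hy3⟩, hy4⟩, hy5⟩, -⟩ := hball _ (hseg δ ⟨hδ0.le, le_rfl⟩)
  set y := x - δ • T with hy
  have hv0 : 0 < ‖v‖ := by
    rw [norm_pos_iff]
    rintro rfl
    simp at hτv
  have hκv := hx1 v hv
  rw [abs_of_neg hτv] at hκv
  have a1 : |(τ x - l) v| ≤ κ / 4 * ‖v‖ :=
    ((τ x - l).le_opNorm v).trans (by gcongr)
  have a2 : |(τ y - l) v| ≤ κ / 4 * ‖v‖ :=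
    ((τ y - l).le_opNorm v).trans (by gcongr)
  have a3 : |(G y T - G x₀ T) v| ≤ κ / 4 * ‖v‖ :=
    ((G y T - G x₀ T).le_opNorm v).trans (by gcongr)
  have a4 : |(G y - G x) v v| ≤ Λ * (δ * ‖T‖) * ‖v‖ * ‖v‖ := by
    have h1 : ‖G y - G x‖ ≤ Λ * (δ * ‖T‖) := by
      have := hΛ.dist_le_mul y hy5 x hx5
      rwa [dist_eq_norm, dist_eq_norm, hy, sub_sub_cancel_left, norm_neg, norm_smul,
        Real.norm_of_nonneg hδ0.le] at this
    exact ((G y - G x).le_opNorm₂ v v).trans (by gcongr)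
  simp only [sub_apply] at a1 a2 a3 a4
  rw [← hτT] at a3
  rw [abs_le] at a1 a2 a3 a4
  -- On future-directed causal vectors l is negative, so the derivative of the shift adds a positive
  -- multiple of T.
  set q := -l v with hq
  have hqv : κ / 2 * ‖v‖ ≤ q := by
    have : κ * ‖v‖ = κ / 2 * ‖v‖ + κ / 4 * ‖v‖ + κ / 4 * ‖v‖ := by ring
    have : 0 < κ / 4 * ‖v‖ := by positivity
    linarith
  have hq0 : 0 < q := lt_of_lt_of_le (by positivity) hqv
  have hlv : l v = -q := by simp [hq]
  have b1 : G y T v ≤ -(κ / 4 * ‖v‖) := by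
    have : κ / 2 * ‖v‖ = κ / 4 * ‖v‖ + κ / 4 * ‖v‖ := by ring
    linarith
  have b2 : τ y v < 0 := by
    have : κ / 2 * ‖v‖ = κ / 4 * ‖v‖ + κ / 4 * ‖v‖ := by ring
    have : 0 < κ / 4 * ‖v‖ := by positivity
    linarith
  rw [hlv]
  have ev : v - (δ * (C * -q)) • T = v + (δ * C * q) • T := by
    rw [show δ * (C * -q) = -(δ * C * q) by ring, neg_smul, sub_neg_eq_add]
  rw [ev]
  have hm : 0 < δ * C * q := by positivity
  simp only [map_add, map_smul, add_apply, smul_apply, smul_eq_mul]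
  constructor
  · rw [hsymm y v T]
    have b3 : G y v v ≤ Λ * (δ * ‖T‖) * ‖v‖ * ‖v‖ := by linarith [a4.2]
    have b4 : δ * C * q * G y T v ≤ -(δ * (Λ * ‖T‖ + 1) / 2 * ‖v‖ * ‖v‖) := by
      calc δ * C * q * G y T v ≤ δ * C * q * -(κ / 4 * ‖v‖) :=
            mul_le_mul_of_nonneg_left b1 hm.le
        _ ≤ δ * C * (κ / 2 * ‖v‖) * -(κ / 4 * ‖v‖) := by
            refine mul_le_mul_of_nonpos_right ?_ (by
              have : 0 < κ / 4 * ‖v‖ := by positivity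
              linarith)
            gcongr
        _ = -(δ * (Λ * ‖T‖ + 1) / 2 * ‖v‖ * ‖v‖) := by
            rw [hC]
            field_simp
    have b5 : δ * C * q * (δ * C * q * G y T T) < 0 :=
      mul_neg_of_pos_of_neg hm (mul_neg_of_pos_of_neg hm hy1)
    have b6 : 0 < δ * ‖v‖ * ‖v‖ := by positivity
    have b7 : 2 * (δ * (Λ * ‖T‖ + 1) / 2 * ‖v‖ * ‖v‖) =
      Λ * (δ * ‖T‖) * ‖v‖ * ‖v‖ + δ * ‖v‖ * ‖v‖ := by ring
    linarith
  · have := mul_neg_of_pos_of_neg hm hy2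
    linarith

end ConeShift

/-! ### Curves in charts and openness of the chronological relation. -/

section

variable {M : Type*} [TopologicalSpace M] [ChartedSpace E4 M]
  {C : ∀ x : M, TangentSpace (𝓡 4) x → Prop}

lemma ReachableIn.map {N : Type*} [TopologicalSpace N] [ChartedSpace E4 N]
    {C' : ∀ x : N, TangentSpace (𝓡 4) x → Prop} {Ψ : M → N} {W : Set M} {p q : M}
    (h : ReachableIn C W p q) (hW : IsOpen W) (hΨ : ContMDiffOn (𝓡 4) (𝓡 4) ∞ Ψ W)
    (hC : ∀ x ∈ W, ∀ v, C x v → C' (Ψ x) (mfderiv (𝓡 4) (𝓡 4) Ψ x v)) :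
    ReachableIn C' (Ψ '' W) (Ψ p) (Ψ q) := by
  obtain ⟨γ, h, rfl, rfl, hγ⟩ := h
  exact ⟨Ψ ∘ γ, h.comp_left hW hΨ hC hγ, rfl, rfl, fun t ht ↦ ⟨γ t, hγ ht, rfl⟩⟩

/-- A straight segment as a curve in the model space. -/
lemma reachableIn_segment {C : ∀ x : E4, TangentSpace (𝓡 4) x → Prop} {W : Set E4} {x u : E4}
    (h : ∀ t ∈ Icc (0 : ℝ) 1, x + t • u ∈ W ∧ C (x + t • u) u) : ReachableIn C W x (x + u) := by
  refine ⟨fun t ↦ x + t • u, ⟨by fun_prop, ∅, by simp, fun a b hab hs _ ↦ ⟨?_, fun t ht ↦ ?_⟩⟩,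
    by simp, by simp, fun t ht ↦ (h t ht).1⟩
  · have : ContDiff ℝ ∞ fun t : ℝ ↦ x + t • u := by fun_prop
    exact this.contMDiff.contMDiffOn
  · have hd : HasDerivWithinAt (fun t : ℝ ↦ x + t • u) u (Icc a b) t := by
      simpa using (((hasDerivAt_id t).smul_const u).const_add x).hasDerivWithinAt
    have := hd.hasFDerivWithinAt.hasMFDerivWithinAt.mfderivWithin (uniqueMDiffWithinAt_Icc hab ht)
    rw [show mfderivWithin 𝓘(ℝ, ℝ) (𝓡 4) (fun t : ℝ ↦ x + t • u) (Icc a b) t (1 : ℝ) = u from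
      (DFunLike.congr_fun this (1 : ℝ)).trans (by
        change (ContinuousLinearMap.toSpanSingleton ℝ u) (1 : ℝ) = u
        simp)]
    exact (h t (hs ht)).2

end

namespace Spacetime

variable {M : Type*} [TopologicalSpace M] [ChartedSpace E4 M] [IsManifold (𝓡 4) ∞ M]
  (g : Spacetime M) (c : M)

/-- Future-directed timelike coordinate vectors. -/
def CoordTimelike (x v : E4) : Prop := g.coordMetric c x v v < 0 ∧ g.coordTime c x v < 0

/-- Future-directed causal coordinate vectors. -/
def CoordCausal (x v : E4) : Prop := g.coordMetric c x v v ≤ 0 ∧ g.coordTime c x v < 0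

lemma frame_mfderiv {x : M} (hx : x ∈ (chartAt E4 c).source) (v : TangentSpace (𝓡 4) x) :
    (frame c (chartAt E4 c x) (mfderiv (𝓡 4) (𝓡 4) (chartAt E4 c) x v) : E4) = v := by
  have h := (mdifferentiable_chart (I := 𝓡 4) c).symm_comp_deriv hx
  exact DFunLike.congr_fun h v

lemma mfderiv_frame {x : E4} (hx : x ∈ (chartAt E4 c).target) (v : E4) :
    (mfderiv (𝓡 4) (𝓡 4) (chartAt E4 c) ((chartAt E4 c).symm x) (frame c x v) : E4) = v := by
  have h := (mdifferentiable_chart (I := 𝓡 4) c).comp_symm_deriv hx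
  exact DFunLike.congr_fun h v

lemma coordMetric_mfderiv {x : M} (hx : x ∈ (chartAt E4 c).source)
    (v w : TangentSpace (𝓡 4) x) :
    g.coordMetric c (chartAt E4 c x) (mfderiv (𝓡 4) (𝓡 4) (chartAt E4 c) x v)
      (mfderiv (𝓡 4) (𝓡 4) (chartAt E4 c) x w) = g.metric x v w := by
  let G : M → E4 →L[ℝ] E4 →L[ℝ] ℝ := g.metric
  have h1 : G ((chartAt E4 c).symm (chartAt E4 c x)) = G x := by
    rw [(chartAt E4 c).left_inv hx]
  have h2 := frame_mfderiv c hx v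
  have h3 := frame_mfderiv c hx w
  change G ((chartAt E4 c).symm (chartAt E4 c x)) _ _ = G x v w
  rw [h1]
  exact congrArg₂ (fun a b ↦ G x a b) h2 h3

lemma coordTime_mfderiv {x : M} (hx : x ∈ (chartAt E4 c).source) (v : TangentSpace (𝓡 4) x) :
    g.coordTime c (chartAt E4 c x) (mfderiv (𝓡 4) (𝓡 4) (chartAt E4 c) x v) =
      g.metric x (g.timeField x) v := by
  let G : M → E4 →L[ℝ] ℝ := fun x ↦ g.metric x (g.timeField x)
  have h1 : G ((chartAt E4 c).symm (chartAt E4 c x)) = G x := by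
    rw [(chartAt E4 c).left_inv hx]
  have h2 := frame_mfderiv c hx v
  change G ((chartAt E4 c).symm (chartAt E4 c x)) _ = G x v
  rw [h1]
  exact congrArg (fun a ↦ G x a) h2

variable {g} in
lemma FutureTimelike.coord {x : M} (hx : x ∈ (chartAt E4 c).source) {v : TangentSpace (𝓡 4) x}
    (h : g.FutureTimelike x v) :
    g.CoordTimelike c (chartAt E4 c x) (mfderiv (𝓡 4) (𝓡 4) (chartAt E4 c) x v) := by
  exact ⟨(g.coordMetric_mfderiv c hx v v).trans_lt h.1, (g.coordTime_mfderiv c hx v).trans_lt h.2⟩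

variable {g} in
lemma FutureCausal.coord {x : M} (hx : x ∈ (chartAt E4 c).source) {v : TangentSpace (𝓡 4) x}
    (h : g.FutureCausal x v) :
    g.CoordCausal c (chartAt E4 c x) (mfderiv (𝓡 4) (𝓡 4) (chartAt E4 c) x v) := by
  exact ⟨(g.coordMetric_mfderiv c hx v v).trans_le h.1, (g.coordTime_mfderiv c hx v).trans_lt h.2⟩

/-- Timelike curves in coordinates are timelike curves. -/
lemma chronologicallyPrecedes_of_coord {x y : E4}
    (h : ReachableIn (M := E4) (g.CoordTimelike c) (chartAt E4 c).target x y) :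
    g.ChronologicallyPrecedes ((chartAt E4 c).symm x) ((chartAt E4 c).symm y) := by
  rw [chronologicallyPrecedes_iff]
  exact (h.map (chartAt E4 c).open_target (contMDiffOn_chart_symm (I := 𝓡 4) (n := ∞) (x := c))
    (C' := g.FutureTimelike) fun x _ v hv ↦ hv).mono (subset_univ _)

variable {g} in
-- The last bit of the curve is replaced by a straight segment in the chart at b. For t near 1 and
-- b' near b, the secant from γ t to b' is close to the end velocity, so the segment is timelike by
-- openness of the cone.
lemma ChronologicallyPrecedes.eventually {a b : M} (h : g.ChronologicallyPrecedes a b) :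
    ∀ᶠ b' in 𝓝 b, g.ChronologicallyPrecedes a b' := by
  obtain ⟨γ, hγ, rfl, rfl⟩ := h
  set φ := chartAt E4 (γ 1) with hφ
  have hφ1 : γ 1 ∈ φ.source := mem_chart_source E4 (γ 1)
  have htl := IsPiecewiseSmoothCurve.mono_set (t := Icc (0 : ℝ) 1) hγ subset_rfl
  obtain ⟨hc, B, hB, H⟩ := hγ
  have hfin := hB 0 1 subset_rfl
  -- a final smooth piece
  obtain ⟨t₀, ht₀, hdis⟩ : ∃ t₀ ∈ Ico (0 : ℝ) 1, Disjoint (Ioo t₀ 1) B := by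
    have hcl : ((B ∩ Icc 0 1) \ {1})ᶜ ∈ 𝓝 (1 : ℝ) :=
      (hfin.subset sdiff_subset).isClosed.isOpen_compl.mem_nhds (by simp)
    obtain ⟨l, ⟨hl0, hl1⟩, hl⟩ := exists_Ioc_subset_of_mem_nhds' hcl (zero_lt_one)
    refine ⟨l, ⟨hl0, hl1⟩, Set.disjoint_left.2 fun t ht htB ↦ hl ⟨ht.1, ht.2.le⟩ ⟨⟨htB, ?_⟩, ht.2.ne⟩⟩
    exact ⟨hl0.trans ht.1.le, ht.2.le⟩
  obtain ⟨hs, hv⟩ := H t₀ 1 ht₀.2 (Icc_subset_Icc_left ht₀.1) hdis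
  have h1 : (1 : ℝ) ∈ Icc t₀ 1 := right_mem_Icc.2 ht₀.2.le
  set w : TangentSpace (𝓡 4) (γ 1) := mfderivWithin 𝓘(ℝ, ℝ) (𝓡 4) γ (Icc t₀ 1) 1 (1 : ℝ) with hw
  have hwt : g.FutureTimelike (γ 1) w := hv 1 h1
  set u : E4 := mfderiv (𝓡 4) (𝓡 4) φ (γ 1) w with hu
  have hcu : g.CoordTimelike (γ 1) (φ (γ 1)) u := hwt.coord (γ 1) hφ1
  have hder : HasDerivWithinAt (φ ∘ γ) u (Icc t₀ 1) 1 := by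
    have k1 : HasMFDerivWithinAt 𝓘(ℝ, ℝ) (𝓡 4) γ (Icc t₀ 1) 1 _ :=
      ((hs 1 h1).mdifferentiableWithinAt (by simp)).hasMFDerivWithinAt
    have k2 : HasMFDerivAt (𝓡 4) (𝓡 4) φ (γ 1) _ :=
      ((mdifferentiable_chart (I := 𝓡 4) (γ 1)).mdifferentiableAt hφ1).hasMFDerivAt
    obtain ⟨L, hL, hLu⟩ : ∃ L : ℝ →L[ℝ] E4,
        HasFDerivWithinAt (φ ∘ γ) L (Icc t₀ 1) 1 ∧ L 1 = u :=
      ⟨_, (k2.comp_hasMFDerivWithinAt 1 k1).hasFDerivWithinAt, rfl⟩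
    rw [← hLu]
    exact hL.hasDerivWithinAt
  have htar : φ.target ∈ 𝓝 (φ (γ 1)) := φ.open_target.mem_nhds (φ.map_source hφ1)
  have hop : ∀ᶠ z : E4 × E4 in 𝓝 (φ (γ 1), u), z.1 ∈ φ.target ∧ g.CoordTimelike (γ 1) z.1 z.2 := by
    have e1 : ContinuousAt (fun z : E4 × E4 ↦ g.coordMetric (γ 1) z.1) (φ (γ 1), u) :=
      ContinuousAt.comp (f := Prod.fst) (x := (φ (γ 1), u))
        ((g.contDiffOn_coordMetric (γ 1)).continuousOn.continuousAt htar) continuousAt_fst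
    have e2 : ContinuousAt (fun z : E4 × E4 ↦ g.coordTime (γ 1) z.1) (φ (γ 1), u) :=
      ContinuousAt.comp (f := Prod.fst) (x := (φ (γ 1), u))
        ((g.contDiffOn_coordTime (γ 1)).continuousOn.continuousAt htar) continuousAt_fst
    have e3 : ContinuousAt (fun z : E4 × E4 ↦ z.2) (φ (γ 1), u) := continuousAt_snd
    refine Filter.Eventually.and (continuousAt_fst.preimage_mem_nhds htar) (Filter.Eventually.and ?_ ?_)
    · exact ((e1.clm_apply e3).clm_apply e3).eventually (gt_mem_nhds hcu.1)
    · exact (e2.clm_apply e3).eventually (gt_mem_nhds hcu.2)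
  rw [nhds_prod_eq, Filter.eventually_prod_iff] at hop
  obtain ⟨P, hP, Q, hQ, hPQ⟩ := hop
  obtain ⟨r, hr, hrP⟩ := Metric.eventually_nhds_iff_ball.1 hP
  have hIoo : Icc t₀ 1 \ {1} = Ico t₀ 1 := Icc_sdiff_right
  rw [hasDerivWithinAt_iff_tendsto_slope, hIoo] at hder
  have hcontin : Filter.Tendsto (φ ∘ γ) (𝓝[Ico t₀ 1] 1) (𝓝 (φ (γ 1))) :=
    ((φ.continuousAt hφ1).comp_continuousWithinAt (hs.continuousOn 1 h1)).mono_left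
      (nhdsWithin_mono _ Ico_subset_Icc_self)
  have hsrc : ∀ᶠ t in 𝓝[Ico t₀ 1] (1 : ℝ), γ t ∈ φ.source :=
    ((hs.continuousOn 1 h1).mono_left (nhdsWithin_mono _ Ico_subset_Icc_self)).eventually
      (φ.open_source.mem_nhds hφ1)
  have : (𝓝[Ico t₀ 1] (1 : ℝ)).NeBot := by
    rw [nhdsWithin_Ico_eq_nhdsLT ht₀.2]; infer_instance
  have hpos : ∀ᶠ t in 𝓝[Ico t₀ 1] (1 : ℝ), 0 < t :=
    nhdsWithin_le_nhds (lt_mem_nhds one_pos)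
  obtain ⟨t, htQ, htb, htI, htsrc, htp⟩ := ((hder.eventually hQ.eventually_nhds).and
    ((hcontin.eventually (Metric.ball_mem_nhds _ hr)).and
      ((eventually_mem_nhdsWithin).and (hsrc.and hpos)))).exists
  have ht1 : 0 < 1 - t := sub_pos.2 htI.2
  -- nearby end points
  have hev : ∀ᶠ y in 𝓝 (φ (γ 1)), Q ((1 - t)⁻¹ • (y - φ (γ t))) ∧ y ∈ Metric.ball (φ (γ 1)) r := by
    refine Filter.Eventually.and ?_ (Metric.ball_mem_nhds _ hr)
    have hct : ContinuousAt (fun y : E4 ↦ (1 - t)⁻¹ • (y - φ (γ t))) (φ (γ 1)) := by fun_prop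
    refine hct.eventually (p := fun z ↦ Q z) ?_
    have : slope (φ ∘ γ) 1 t = (1 - t)⁻¹ • (φ (γ 1) - φ (γ t)) := by
      rw [slope_def_module, Function.comp, Function.comp, ← neg_sub (φ (γ 1)), smul_neg,
        ← neg_smul, ← inv_neg, neg_sub]
    rwa [this] at htQ
  filter_upwards [(φ.continuousAt hφ1).eventually hev, φ.open_source.mem_nhds hφ1] with b hb hbs
  have hat : g.ChronologicallyPrecedes (γ 0) (γ t) := by
    rw [chronologicallyPrecedes_iff]
    exact ((htl.mono_set (Icc_subset_Icc_right htI.2.le)).reachableIn htp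
      g.futureTimelike_smul).mono (subset_univ _)
  refine hat.trans ?_
  have key := g.chronologicallyPrecedes_of_coord (γ 1) (x := φ (γ t))
    (y := φ (γ t) + (φ b - φ (γ t))) ?_
  · rw [add_sub_cancel] at key
    rwa [φ.left_inv htsrc, φ.left_inv hbs] at key
  · refine reachableIn_segment fun s hs ↦ ?_
    have hmem : φ (γ t) + s • (φ b - φ (γ t)) ∈ Metric.ball (φ (γ 1)) r :=
      (convex_ball _ _).add_smul_sub_mem htb hb.2 hs
    obtain ⟨m1, m2⟩ := hPQ (hrP _ hmem) hb.1
    refine ⟨m1, ?_⟩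
    -- What is known to be timelike is the secant divided by 1 - t; the positive factor is now
    -- cancelled.
    simp only [CoordTimelike, map_smul, smul_apply, smul_eq_mul] at m2
    have hi : 0 < (1 - t)⁻¹ := inv_pos.2 ht1
    exact ⟨(pos_iff_neg_of_mul_neg (((pos_iff_neg_of_mul_neg m2.1).1 hi))).1 hi,
      (pos_iff_neg_of_mul_neg m2.2).1 hi⟩

variable {g} in
lemma ChronologicallyPrecedes.eventually_left {a b : M} (h : g.ChronologicallyPrecedes a b) :
    ∀ᶠ a' in 𝓝 a, g.ChronologicallyPrecedes a' b := by
  simpa only [reverse_chronologicallyPrecedes] using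
    (reverse_chronologicallyPrecedes.2 h).eventually

lemma isOpen_chronologicalFuture (S : Set M) : IsOpen (g.chronologicalFuture S) :=
  isOpen_iff_mem_nhds.2 fun _ ⟨s, hs, h⟩ ↦ h.eventually.mono fun _ h' ↦ ⟨s, hs, h'⟩

lemma isOpen_chronologicalPast (S : Set M) : IsOpen (g.chronologicalPast S) :=
  isOpen_iff_mem_nhds.2 fun _ ⟨s, hs, h⟩ ↦ h.eventually_left.mono fun _ h' ↦ ⟨s, hs, h'⟩

/-- A causal vector orthogonal to a timelike one vanishes. -/
lemma eq_zero_of_orthogonal {x : M} {t v : TangentSpace (𝓡 4) x} (ht : g.metric x t t < 0)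
    (hv : g.metric x v v ≤ 0) (htv : g.metric x t v = 0) : v = 0 := by
  obtain ⟨e, he⟩ := g.signature x
  have expand (a b : TangentSpace (𝓡 4) x) : g.metric x a b =
      -(e.repr a 0 * e.repr b 0) + e.repr a 1 * e.repr b 1 + e.repr a 2 * e.repr b 2 +
        e.repr a 3 * e.repr b 3 := by
    conv_lhs => rw [← e.sum_repr a, ← e.sum_repr b]
    simp only [map_sum, map_smul, sum_apply, smul_apply, smul_eq_mul, he]
    simp [Fin.sum_univ_four, Matrix.diagonal]
    ring
  rw [expand] at ht hv htv
  have hz : ∀ i, e.repr v i = 0 := by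
    generalize e.repr t = t at *
    generalize e.repr v = v at *
    set v0 := v 0
    set v1 := v 1
    set v2 := v 2
    set v3 := v 3
    set t0 := t 0
    set t1 := t 1
    set t2 := t 2
    set t3 := t 3
    -- Cauchy–Schwarz on the spatial parts. With orthogonality, (t0 v0)² ≤ |t|²|v|² ≤ |t|² v0², and
    -- |t|² < t0² then forces v0 = 0; here |t| and |v| are the spatial norms.
    have cs : (t1 * v1 + t2 * v2 + t3 * v3) ^ 2 ≤
        (t1 * t1 + t2 * t2 + t3 * t3) * (v1 * v1 + v2 * v2 + v3 * v3) := by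
      nlinarith [sq_nonneg (t1 * v2 - t2 * v1), sq_nonneg (t1 * v3 - t3 * v1),
        sq_nonneg (t2 * v3 - t3 * v2)]
    have e1 : t1 * v1 + t2 * v2 + t3 * v3 = t0 * v0 := by linarith
    rw [e1] at cs
    have hT : 0 ≤ t1 * t1 + t2 * t2 + t3 * t3 :=
      add_nonneg (add_nonneg (mul_self_nonneg _) (mul_self_nonneg _)) (mul_self_nonneg _)
    have h0 : v0 = 0 := by
      by_contra h
      have hp : 0 < v0 * v0 := mul_self_pos.2 h
      have : (t1 * t1 + t2 * t2 + t3 * t3) * (v1 * v1 + v2 * v2 + v3 * v3) ≤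
        (t1 * t1 + t2 * t2 + t3 * t3) * (v0 * v0) := mul_le_mul_of_nonneg_left (by linarith) hT
      have : (t1 * t1 + t2 * t2 + t3 * t3) * (v0 * v0) < t0 * t0 * (v0 * v0) :=
        mul_lt_mul_of_pos_right (by linarith) hp
      nlinarith
    rw [h0] at hv
    have n1 := mul_self_nonneg v1
    have n2 := mul_self_nonneg v2
    have n3 := mul_self_nonneg v3
    intro i
    fin_cases i
    · exact h0
    · exact (mul_self_eq_zero.1 (by linarith) : v1 = 0)
    · exact (mul_self_eq_zero.1 (by linarith) : v2 = 0)
    · exact (mul_self_eq_zero.1 (by linarith) : v3 = 0)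
  apply e.repr.injective
  ext i
  simp [hz i]

end Spacetime

/-! ### Local limits of causal curves and the push-up property. -/

namespace Spacetime

variable {M : Type*} [TopologicalSpace M] [ChartedSpace E4 M] [IsManifold (𝓡 4) ∞ M]
  (g : Spacetime M)

/-- Near each point there are arbitrarily small maps towards the past that turn causal curves into
timelike ones. -/
lemma exists_local_shift (p : M) : ∃ W : Set M, IsOpen W ∧ p ∈ W ∧ ∃ Φ : ℝ → M → M, ∃ ε₀ > 0,
    (∀ y ∈ W, Filter.Tendsto (fun ε ↦ Φ ε y) (𝓝[>] 0) (𝓝 y)) ∧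
    ∀ ε ∈ Ioo 0 ε₀, ContinuousOn (Φ ε) W ∧
      (∀ y ∈ W, g.ChronologicallyPrecedes (Φ ε y) y ∧ Φ ε y ≠ y) ∧
      ∀ y z, ReachableIn g.FutureCausal W y z → g.ChronologicallyPrecedes (Φ ε y) (Φ ε z) := by
  set φ := chartAt E4 p with hφ
  have hp : p ∈ φ.source := mem_chart_source E4 p
  have hx₀ : φ p ∈ φ.target := φ.map_source hp
  let X : M → E4 := g.timeField
  let Gm : M → E4 →L[ℝ] E4 →L[ℝ] ℝ := g.metric
  set T : E4 := mfderiv (𝓡 4) (𝓡 4) φ p (g.timeField p) with hTdef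
  have hT : g.coordMetric p (φ p) T T < 0 :=
    (g.coordMetric_mfderiv p hp _ _).trans_lt (g.timelike_timeField p)
  have hXT : X (φ.symm (φ p)) = frame p (φ p) T :=
    (congrArg X (φ.left_inv hp)).trans (frame_mfderiv p hp (g.timeField p)).symm
  have hτT : g.coordTime p (φ p) = g.coordMetric p (φ p) T := by
    ext v
    exact congrArg (fun a ↦ Gm (φ.symm (φ p)) a (frame p (φ p) v)) hXT
  have hL : ∀ v, g.coordTime p (φ p) v = 0 → g.coordMetric p (φ p) v v ≤ 0 → v = 0 := by
    intro v h1 h2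
    have h3 : frame p (φ p) v = 0 :=
      g.eq_zero_of_orthogonal (g.timelike_timeField (φ.symm (φ p))) h2 h1
    rw [← mfderiv_frame p hx₀ v, h3]
    exact map_zero _
  have hT0 : T ≠ 0 := by
    intro h
    simp [h] at hT
  obtain ⟨W, hWU, hW, hpW, C, ε₀, hε₀, H⟩ := exists_expShift φ.open_target hx₀
    (g.contDiffOn_coordMetric p) (g.contDiffOn_coordTime p).continuousOn
    (fun x v w ↦ g.symm _ _ _) hT hτT hL
  set F := expShift (g.coordTime p (φ p)) T (φ p) C with hF
  have hFsm (ε : ℝ) : ContDiff ℝ ∞ (F ε) := contDiff_expShift _ _ _ _ _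
  have hFU : ∀ ε ∈ Ioo 0 ε₀, MapsTo (F ε) W φ.target := by
    intro ε hε x hx
    obtain ⟨⟨δ, hδ, h1, h2⟩, -⟩ := H ε hε x hx
    rw [h1]
    exact (h2 δ ⟨hδ.le, le_rfl⟩).1
  refine ⟨φ.source ∩ φ ⁻¹' W, φ.isOpen_inter_preimage hW, ⟨hp, hpW⟩,
    fun ε y ↦ φ.symm (F ε (φ y)), ε₀, hε₀, ?_, ?_⟩
  · rintro y ⟨hy, hyW⟩
    have h1 : Filter.Tendsto (fun ε ↦ F ε (φ y)) (𝓝 0) (𝓝 (φ y)) := by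
      have : Continuous fun ε ↦ F ε (φ y) := by
        simp only [hF, expShift]
        fun_prop
      have h2 := this.tendsto 0
      simpa [hF, expShift] using h2
    have h3 := (φ.symm.continuousAt (φ.map_source hy)).tendsto.comp h1
    simp only [φ.left_inv hy] at h3
    exact h3.mono_left nhdsWithin_le_nhds
  intro ε hε
  refine ⟨?_, ?_, ?_⟩
  · exact φ.symm.continuousOn.comp ((hFsm ε).continuous.comp_continuousOn
      (φ.continuousOn.mono inter_subset_left)) fun y hy ↦ hFU ε hε hy.2
  · rintro y ⟨hy, hyW⟩
    obtain ⟨⟨δ, hδ, h1, h2⟩, -⟩ := H ε hε _ hyW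
    constructor
    · have key := g.chronologicallyPrecedes_of_coord p (x := F ε (φ y))
        (y := F ε (φ y) + δ • T) ?_
      · have e : F ε (φ y) + δ • T = φ y := by rw [h1]; abel
        rw [e] at key
        rwa [φ.left_inv hy] at key
      · refine reachableIn_segment fun t ht ↦ ?_
        have e : F ε (φ y) + t • δ • T = φ y - ((1 - t) * δ) • T := by
          rw [h1, sub_mul, sub_smul, one_mul, mul_smul]
          abel
        rw [e]
        obtain ⟨k1, k2, k3⟩ := h2 ((1 - t) * δ)
          ⟨mul_nonneg (by linarith [ht.2]) hδ.le, by nlinarith [ht.1]⟩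
        refine ⟨k1, ?_, ?_⟩
        · simp only [map_smul, smul_apply, smul_eq_mul]
          exact mul_neg_of_pos_of_neg hδ (mul_neg_of_pos_of_neg hδ k2)
        · simp only [map_smul, smul_eq_mul]
          exact mul_neg_of_pos_of_neg hδ k3
    · intro h
      have e := congrArg φ h
      rw [φ.right_inv (hFU ε hε hyW), h1, sub_eq_self] at e
      exact (smul_ne_zero hδ.ne' hT0) e
  · intro y z hyz
    have s1 : ReachableIn (g.CoordCausal p) W (φ y) (φ z) :=
      (hyz.map (φ.isOpen_inter_preimage hW) ((contMDiffOn_chart (I := 𝓡 4) (n := ∞)).mono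
        inter_subset_left) fun x hx v hv ↦ hv.coord p hx.1).mono
        (image_subset_iff.2 fun x hx ↦ hx.2)
    have s2 : ReachableIn (g.CoordTimelike p) φ.target (F ε (φ y)) (F ε (φ z)) := by
      refine (s1.map hW (hFsm ε).contMDiff.contMDiffOn fun x hx v hv ↦ ?_).mono
        (image_subset_iff.2 (hFU ε hε))
      rw [mfderiv_eq_fderiv]
      exact (H ε hε x hx).2 v hv.1 hv.2
    exact g.chronologicallyPrecedes_of_coord p s2

/-- That q differs from p gives a chain towards the past a step of positive length near every point.
-/
lemma exists_chronologicallyPrecedes_ne (p : M) :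
    ∃ q, g.ChronologicallyPrecedes q p ∧ q ≠ p := by
  obtain ⟨W, -, hp, Φ, ε₀, hε₀, -, H⟩ := g.exists_local_shift p
  exact ⟨_, (H (ε₀ / 2) ⟨half_pos hε₀, half_lt_self hε₀⟩).2.1 p hp⟩

/-- Limits of causally related points, connected by causal curves in a small neighbourhood, are
related by the inclusion of their chronological pasts. -/
lemma exists_local_closure (p : M) : ∃ W : Set M, IsOpen W ∧ p ∈ W ∧
    ∀ {ι : Type _} (l : Filter ι) [l.NeBot] (y z : ι → M) (y₀ z₀ : M), y₀ ∈ W → z₀ ∈ W →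
      Filter.Tendsto y l (𝓝 y₀) → Filter.Tendsto z l (𝓝 z₀) →
      (∀ᶠ i in l, y i = z i ∨ ReachableIn g.FutureCausal W (y i) (z i)) →
      ∀ a, g.ChronologicallyPrecedes a y₀ → g.ChronologicallyPrecedes a z₀ := by
  obtain ⟨W, hW, hp, Φ, ε₀, hε₀, hlim, H⟩ := g.exists_local_shift p
  refine ⟨W, hW, hp, fun {ι} l _ y z y₀ z₀ hy₀ hz₀ hy hz hyz a ha ↦ ?_⟩
  -- ε is fixed first, by openness of the future of a; for suitable i then a ≪ Φ ε (y i) ≪ Φ ε (z i)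
  -- ≪ z₀, the middle relation being an equality if y i = z i.
  obtain ⟨ε, haε, hε⟩ := (((hlim y₀ hy₀).eventually ha.eventually).and
    (Ioo_mem_nhdsGT hε₀)).exists
  obtain ⟨hc, hpast, hmap⟩ := H ε hε
  have h1 : ∀ᶠ i in l, g.ChronologicallyPrecedes a (Φ ε (y i)) :=
    ((hc.continuousAt (hW.mem_nhds hy₀)).tendsto.comp hy).eventually haε.eventually
  have h2 : ∀ᶠ i in l, g.ChronologicallyPrecedes (Φ ε (z i)) z₀ :=
    ((hc.continuousAt (hW.mem_nhds hz₀)).tendsto.comp hz).eventually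
      (hpast z₀ hz₀).1.eventually_left
  obtain ⟨i, hi1, hi2, hi⟩ := (h1.and (h2.and hyz)).exists
  rcases hi with hi | hi
  · rw [hi] at hi1
    exact hi1.trans hi2
  · exact (hi1.trans (hmap _ _ hi)).trans hi2

variable {g}

/-- Push-up: a timelike curve followed by a causal one can be replaced by a timelike one. -/
lemma ChronologicallyPrecedes.trans_causal {a p q : M} (h : g.ChronologicallyPrecedes a p)
    (h' : g.CausallyPrecedes p q) : g.ChronologicallyPrecedes a q := by
  obtain rfl | ⟨γ, hγ, rfl, rfl⟩ := h'
  · exact h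
  choose W hW hpW H using g.exists_local_closure
  let δ : unitInterval → M := fun t ↦ γ t
  have hδ : Continuous δ := continuousOn_iff_continuous_domRestrict.1 hγ.1
  -- The curve is cut into finitely many pieces, each inside one W; the relation a ≪ · passes along
  -- each by the local closure property with constant sequences.
  obtain ⟨t, ht0, htm, ⟨N, hN⟩, ht⟩ := exists_monotone_Icc_subset_open_cover_unitInterval
    (c := fun x : M ↦ δ ⁻¹' W x) (fun x ↦ (hW x).preimage hδ)
    (fun s _ ↦ mem_iUnion.2 ⟨δ s, hpW (δ s)⟩)
  have key : ∀ n, g.ChronologicallyPrecedes a (δ (t n)) := by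
    intro n
    induction n with
    | zero => rw [ht0]; exact h
    | succ n ih =>
      obtain ⟨x, hx⟩ := ht n
      have hle : t n ≤ t (n + 1) := htm n.le_succ
      refine H x (⊤ : Filter Unit) (fun _ ↦ δ (t n)) (fun _ ↦ δ (t (n + 1))) _ _
        (hx (left_mem_Icc.2 hle)) (hx (right_mem_Icc.2 hle)) tendsto_const_nhds
        tendsto_const_nhds (Filter.Eventually.of_forall fun _ ↦ ?_) a ih
      rcases hle.eq_or_lt with he | hlt
      · exact Or.inl (by rw [he])
      · refine Or.inr (((hγ.mono_set (Icc_subset_Icc (t n).2.1 (t (n + 1)).2.2)).reachableIn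
          (Subtype.coe_lt_coe.2 hlt) g.futureCausal_smul).mono ?_)
        rintro _ ⟨s, hs, rfl⟩
        exact hx (show (⟨s, (t n).2.1.trans hs.1, hs.2.trans (t (n + 1)).2.2⟩ : unitInterval) ∈
          Icc (t n) (t (n + 1)) from ⟨hs.1, hs.2⟩)
  have := key N
  rw [hN N le_rfl] at this
  exact this

end Spacetime

/-- If steps of a size bounded below are possible near each point, then there is an infinite
sequence of steps that does not converge. -/
lemma exists_nonconvergent_steps {X σ : Type*} [MetricSpace X] (pos : σ → X) (Step : σ → σ → Prop)
    (h : ∀ p : X, ∃ r > 0, ∀ s, dist (pos s) p < r → ∃ s', Step s s' ∧ r ≤ dist (pos s) (pos s'))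
    (s₀ : σ) : ∃ u : ℕ → σ, u 0 = s₀ ∧ (∀ n, Step (u n) (u (n + 1))) ∧
      ∀ p, ¬ Filter.Tendsto (fun n ↦ pos (u n)) Filter.atTop (𝓝 p) := by
  -- Greedy choice: take at least half of the supremum of the available step lengths, truncated at 1
  -- to keep it finite.
  have hbest : ∀ s, ∃ s', Step s s' ∧ ∀ s'', Step s s'' →
      min 1 (dist (pos s) (pos s'')) ≤ 2 * min 1 (dist (pos s) (pos s')) := by
    intro s
    set D : Set ℝ := (fun s' ↦ min 1 (dist (pos s) (pos s'))) '' {s' | Step s s'}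
    have hbdd : BddAbove D := ⟨1, by rintro _ ⟨s', -, rfl⟩; exact min_le_left _ _⟩
    obtain ⟨r, hr, H⟩ := h (pos s)
    obtain ⟨s₁, hs₁, hrs₁⟩ := H s (by simpa using hr)
    have hm₁ : min 1 (dist (pos s) (pos s₁)) ∈ D := ⟨s₁, hs₁, rfl⟩
    have hpos : 0 < sSup D :=
      (lt_min one_pos (hr.trans_le hrs₁)).trans_le (le_csSup hbdd hm₁)
    obtain ⟨_, ⟨s', hs', rfl⟩, hlt⟩ := exists_lt_of_lt_csSup ⟨_, hm₁⟩ (half_lt_self hpos)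
    refine ⟨s', hs', fun s'' hs'' ↦ ?_⟩
    have : min 1 (dist (pos s) (pos s'')) ≤ sSup D := le_csSup hbdd ⟨s'', hs'', rfl⟩
    have hlt' : sSup D / 2 < min 1 (dist (pos s) (pos s')) := hlt
    linarith
  choose nxt hstep hnxt using hbest
  let u : ℕ → σ := fun n ↦ nxt^[n] s₀
  have hu : ∀ n, u (n + 1) = nxt (u n) := fun n ↦ Function.iterate_succ_apply' _ _ _
  refine ⟨u, rfl, fun n ↦ by rw [hu]; exact hstep _, fun p hp ↦ ?_⟩
  -- Near a limit p a step of length at least r is always available, so the chosen lengths could not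
  -- tend to 0.
  obtain ⟨r, hr, H⟩ := h p
  have hd : Filter.Tendsto (fun n ↦ dist (pos (u n)) (pos (u (n + 1)))) Filter.atTop (𝓝 0) := by
    simpa using hp.dist (hp.comp (Filter.tendsto_add_atTop_nat 1))
  have hm : 0 < min 1 r / 2 := by positivity
  obtain ⟨n, hn1, hn2⟩ := ((hd.eventually (gt_mem_nhds hm)).and
    (hp.eventually (Metric.ball_mem_nhds p hr))).exists
  obtain ⟨s', hs', hrs'⟩ := H _ hn2
  have h1 := hnxt (u n) s' hs'
  rw [← hu] at h1
  have h2 : min 1 r ≤ min 1 (dist (pos (u n)) (pos s')) := min_le_min_left 1 hrs'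
  have h3 : min 1 (dist (pos (u n)) (pos (u (n + 1)))) ≤ dist (pos (u n)) (pos (u (n + 1))) :=
    min_le_right _ _
  linarith

/-! ### Inextensible timelike curves and Cauchy hypersurfaces. -/

namespace Spacetime

variable {M : Type*} [TopologicalSpace M] [ChartedSpace E4 M] [IsManifold (𝓡 4) ∞ M]
  {g : Spacetime M}

/-- A doubly infinite chronological chain lies on a timelike curve. -/
lemma exists_timelike_curve {a : ℤ → M} (ha : ∀ n, g.ChronologicallyPrecedes (a n) (a (n + 1))) :
    ∃ γ : ℝ → M, IsPiecewiseSmoothCurve g.FutureTimelike γ univ ∧ ∀ n : ℤ, γ n = a n := by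
  choose δ hδ h0 h1 using ha
  refine ⟨fun t ↦ δ ⌊t⌋ (t - ⌊t⌋), isPiecewiseSmoothCurve_univ fun n ↦ ?_, fun n ↦ by simp [h0]⟩
  refine (((hδ n).comp_affine one_ne_zero (-n) (g.futureTimelike_smul 1 one_pos)).mono_set
    ?_).congr ?_
  · rintro t ⟨ht, ht'⟩
    constructor <;> linarith
  · rintro t ⟨ht, ht'⟩
    rcases ht'.lt_or_eq with h | rfl
    · have : ⌊t⌋ = n := Int.floor_eq_iff.2 ⟨ht, h⟩
      simp [this, sub_eq_add_neg]
    · simp [h0, h1]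

/-- A point of the curve shortly before its end. It lets a chronological chain stay as close to
prescribed points as desired. -/
lemma ChronologicallyPrecedes.exists_between {a b : M} (h : g.ChronologicallyPrecedes a b)
    {N : Set M} (hN : N ∈ 𝓝 b) :
    ∃ q ∈ N, g.ChronologicallyPrecedes a q ∧ g.ChronologicallyPrecedes q b := by
  obtain ⟨γ, hγ, rfl, rfl⟩ := h
  have hc := hγ.1 1 (right_mem_Icc.2 zero_le_one)
  have h1 : ∀ᶠ t in 𝓝[Ioo (0 : ℝ) 1] 1, γ t ∈ N :=
    (hc.mono Ioo_subset_Icc_self).eventually hN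
  have : (𝓝[Ioo (0 : ℝ) 1] (1 : ℝ)).NeBot := by
    rw [nhdsWithin_Ioo_eq_nhdsLT one_pos]; infer_instance
  obtain ⟨t, ht, htI⟩ := (h1.and eventually_mem_nhdsWithin).exists
  simp only [chronologicallyPrecedes_iff]
  exact ⟨γ t, ht, ((IsPiecewiseSmoothCurve.mono_set hγ (Icc_subset_Icc_right htI.2.le)).reachableIn
      htI.1 g.futureTimelike_smul).mono (subset_univ _),
    ((IsPiecewiseSmoothCurve.mono_set hγ (Icc_subset_Icc_left htI.1.le)).reachableIn
      htI.2 g.futureTimelike_smul).mono (subset_univ _)⟩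

/-- A causal curve that leaves a ball passes through the boundary sphere. -/
lemma CausallyPrecedes.exists_exit {X : Type*} [MetricSpace X] [ChartedSpace E4 X]
    [IsManifold (𝓡 4) ∞ X] {g : Spacetime X} {x y p : X} {r : ℝ} (h : g.CausallyPrecedes x y)
    (hx : dist x p < r) (hy : r < dist y p) :
    ∃ z ∈ Metric.sphere p r, ReachableIn g.FutureCausal (Metric.closedBall p r) x z ∧
      g.CausallyPrecedes z y := by
  obtain rfl | ⟨γ, hγ, rfl, rfl⟩ := h
  · exact absurd hx hy.not_gt
  have hγc : ContinuousOn γ (Icc 0 1) := hγ.1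
  have hc : ContinuousOn (fun t ↦ dist (γ t) p) (Icc 0 1) := 
    continuous_dist.comp_continuousOn (hγc.prodMk continuousOn_const)
  -- The first time on the sphere: leaving the closed ball before it would mean an earlier crossing.
  obtain ⟨t, ⟨htI, htr⟩, hmin⟩ : ∃ t, IsLeast (Icc (0 : ℝ) 1 ∩ (fun t ↦ dist (γ t) p) ⁻¹' {r}) t := by
    refine (isCompact_Icc.of_isClosed_subset (hc.preimage_isClosed_of_isClosed isClosed_Icc
      isClosed_singleton) inter_subset_left).exists_isLeast ?_
    obtain ⟨t, ht, h⟩ := intermediate_value_Icc zero_le_one hc ⟨hx.le, hy.le⟩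
    exact ⟨t, ht, h⟩
  have htr' : dist (γ t) p = r := htr
  have ht0 : 0 < t := by
    refine htI.1.lt_of_ne ?_
    rintro rfl
    exact hx.ne htr'
  have ht1 : t < 1 := by
    refine htI.2.lt_of_ne ?_
    rintro rfl
    exact hy.ne' htr'
  refine ⟨γ t, htr, ((IsPiecewiseSmoothCurve.mono_set hγ (Icc_subset_Icc_right htI.2)).reachableIn
    ht0 g.futureCausal_smul).mono ?_, causallyPrecedes_iff.2 (Or.inr
      (((IsPiecewiseSmoothCurve.mono_set hγ (Icc_subset_Icc_left htI.1)).reachableIn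
    ht1 g.futureCausal_smul).mono (subset_univ _)))⟩
  rintro _ ⟨s, hs, rfl⟩
  rw [Metric.mem_closedBall]
  by_contra! hlt
  obtain ⟨s', hs', h⟩ := intermediate_value_Icc hs.1
    (hc.mono (Icc_subset_Icc_right (hs.2.trans htI.2))) ⟨hx.le, hlt.le⟩
  have h1 := hmin ⟨⟨hs'.1, hs'.2.trans (hs.2.trans htI.2)⟩, h⟩
  have h2 : s = t := le_antisymm hs.2 (h1.trans hs'.2)
  rw [h2] at hlt
  exact hlt.ne' htr'

/-- Points of `J⁺(K)` that leave every compact set end up in the chronological future of a Cauchy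
hypersurface. -/
lemma IsCauchyHypersurface.mem_ultrafilter [T2Space M] [SecondCountableTopology M] {S K : Set M}
    (hS : g.IsCauchyHypersurface S) (hK : IsCompact K) (𝒰 : Ultrafilter M)
    (h𝒰 : (𝒰 : Filter M) ≤ Filter.cocompact M) (hJ : g.causalFuture K ∈ 𝒰) :
    g.chronologicalFuture S ∈ 𝒰 := by
  have : LocallyCompactSpace M := Manifold.locallyCompact_of_finiteDimensional (𝓡 4)
  have : TopologicalSpace.MetrizableSpace M := Manifold.metrizableSpace (𝓡 4) M
  let _ : MetricSpace M := TopologicalSpace.metrizableSpaceMetric M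
  have hMne : Nonempty M := by
    obtain ⟨x, -⟩ := Filter.nonempty_of_mem hJ
    exact ⟨x⟩
  -- A state is a choice of a causal predecessor of 𝒰-almost every x, convergent along 𝒰, together
  -- with its limit. The limits play the role of points on a limit curve.
  let σ := {s : (M → M) × M // Filter.Tendsto s.1 𝒰 (𝓝 s.2) ∧
    ∀ᶠ x in (𝒰 : Filter M), g.CausallyPrecedes (s.1 x) x}
  -- Inclusion of chronological pasts is the relation between limit points that the local closure
  -- property provides.
  let Step : σ → σ → Prop := fun s s' ↦
    ∀ a, g.ChronologicallyPrecedes a s.1.2 → g.ChronologicallyPrecedes a s'.1.2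
  have hstart : ∃ s : σ, True := by
    obtain ⟨f, hf⟩ := Filter.Eventually.choice (l := (𝒰 : Filter M)) hJ
    have hfK : K ∈ 𝒰.map f := hf.mono fun x hx ↦ hx.1
    obtain ⟨k, -, hk⟩ := hK.ultrafilter_le_nhds' _ hfK
    exact ⟨⟨(f, k), hk, hf.mono fun x hx ↦ hx.2⟩, trivial⟩
  obtain ⟨s₀, -⟩ := hstart
  have hlocal : ∀ p : M, ∃ r > 0, ∀ s : σ, dist s.1.2 p < r →
      ∃ s' : σ, Step s s' ∧ r ≤ dist s.1.2 s'.1.2 := by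
    intro p
    obtain ⟨W, hW, hpW, H⟩ := g.exists_local_closure p
    obtain ⟨r₁, hr₁, hc₁⟩ := Metric.exists_isCompact_closedBall p
    obtain ⟨r₂, hr₂, hc₂⟩ := Metric.isOpen_iff.1 hW p hpW
    -- From within r of p to the sphere of radius 2r is a move of at least r, and the closed ball of
    -- radius 2r is compact and inside W.
    set r := min r₁ r₂ / 3 with hr
    have hr0 : 0 < r := by positivity
    have hle1 : 2 * r ≤ r₁ := by
      have := min_le_left r₁ r₂
      linarith
    have hlt2 : 2 * r < r₂ := by
      have := min_le_right r₁ r₂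
      have : 0 < min r₁ r₂ := by positivity
      linarith
    have hcomp : IsCompact (Metric.closedBall p (2 * r)) :=
      hc₁.of_isClosed_subset Metric.isClosed_closedBall (Metric.closedBall_subset_closedBall hle1)
    have hsub : Metric.closedBall p (2 * r) ⊆ W :=
      (Metric.closedBall_subset_ball hlt2).trans hc₂
    refine ⟨r, hr0, ?_⟩
    rintro ⟨⟨f, z⟩, hfz, hfx⟩ hzp
    have e1 : ∀ᶠ x in (𝒰 : Filter M), dist (f x) p < r :=
      hfz.eventually (Metric.isOpen_ball.mem_nhds hzp)
    -- 𝒰 escapes compact sets, so the causal curve from f x to x has to leave the ball.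
    have e2 : ∀ᶠ x in (𝒰 : Filter M), x ∈ (Metric.closedBall p (2 * r))ᶜ :=
      h𝒰 hcomp.compl_mem_cocompact
    have e3 : ∀ᶠ x in (𝒰 : Filter M), ∃ y, y ∈ Metric.sphere p (2 * r) ∧
        ReachableIn g.FutureCausal (Metric.closedBall p (2 * r)) (f x) y ∧
        g.CausallyPrecedes y x := by
      filter_upwards [e1, e2, hfx] with x h1 h2 h3
      exact h3.exists_exit (by linarith) (by simpa using h2)
    obtain ⟨f', hf'⟩ := e3.choice
    have hsph : IsCompact (Metric.sphere p (2 * r)) :=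
      hcomp.of_isClosed_subset Metric.isClosed_sphere Metric.sphere_subset_closedBall
    obtain ⟨y, hy, hfy⟩ := hsph.ultrafilter_le_nhds' (𝒰.map f') (hf'.mono fun x hx ↦ hx.1)
    refine ⟨⟨(f', y), hfy, hf'.mono fun x hx ↦ hx.2.2⟩, ?_, ?_⟩
    · refine H (𝒰 : Filter M) f f' z y (hsub ?_) (hsub (Metric.sphere_subset_closedBall hy)) hfz
        hfy (hf'.mono fun x hx ↦ Or.inr (hx.2.1.mono hsub))
      exact Metric.mem_closedBall.2 (by have : dist z p < r := hzp; linarith)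
    · have h1 : dist z p < r := hzp
      have h2 : dist y p = 2 * r := hy
      have h3 : dist y p ≤ dist z y + dist z p := by
        rw [dist_comm z y]; exact dist_triangle _ _ _
      change r ≤ dist z y
      linarith
  obtain ⟨u, -, hstep, hu⟩ := exists_nonconvergent_steps (fun s : σ ↦ s.1.2) Step hlocal s₀
  set z : ℕ → M := fun n ↦ (u n).1.2
  -- a chronological chain below the sequence of limit points
  have hbelow : ∀ n (a : {a // g.ChronologicallyPrecedes a (z n) ∧ dist a (z n) < 1 / (n + 1)}),
      ∃ b : {b // g.ChronologicallyPrecedes b (z (n + 1)) ∧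
        dist b (z (n + 1)) < 1 / (((n + 1 : ℕ) : ℝ) + 1)},
        g.ChronologicallyPrecedes (a : M) b := by
    rintro n ⟨a, ha, -⟩
    -- The links approach the limit points, so convergence of the chain would force convergence of
    -- z.
    obtain ⟨q, hq, h1, h2⟩ := (hstep n a ha).exists_between
      (Metric.ball_mem_nhds (z (n + 1)) (ε := 1 / (((n + 1 : ℕ) : ℝ) + 1)) (by positivity))
    exact ⟨⟨q, h2, hq⟩, h1⟩
  choose nxt hnxt using hbelow
  obtain ⟨q₀, hq₀, -⟩ := g.exists_chronologicallyPrecedes_ne (z 0)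
  obtain ⟨a₀, ha₀, -, ha₀'⟩ := hq₀.exists_between
    (Metric.ball_mem_nhds (z 0) (ε := 1 / (((0 : ℕ) : ℝ) + 1)) (by positivity))
  let A : ∀ n : ℕ, {a // g.ChronologicallyPrecedes a (z n) ∧ dist a (z n) < 1 / ((n : ℝ) + 1)} :=
    fun n ↦ Nat.rec (motive := fun n ↦
      {a // g.ChronologicallyPrecedes a (z n) ∧ dist a (z n) < 1 / ((n : ℝ) + 1)}) ⟨a₀, ha₀', ha₀⟩ (fun n a ↦ nxt n a) n
  have hA : ∀ n, g.ChronologicallyPrecedes (A n : M) (A (n + 1)) := fun n ↦ hnxt n (A n)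
  -- a chronological chain to the past
  obtain ⟨b, hb0, hb, hbconv⟩ := exists_nonconvergent_steps (fun x : M ↦ x)
    (fun x y ↦ g.ChronologicallyPrecedes y x) (fun p ↦ by
      obtain ⟨q, hq, hne⟩ := g.exists_chronologicallyPrecedes_ne p
      obtain ⟨r, hr, hball⟩ := Metric.eventually_nhds_iff_ball.1 hq.eventually
      have hd : 0 < dist q p := dist_pos.2 hne
      refine ⟨min r (dist q p / 2), by positivity, fun s hs ↦ ⟨q, hball s ?_, ?_⟩⟩
      · exact hs.trans_le (min_le_left _ _)
      · have h1 : dist s p < dist q p / 2 := hs.trans_le (min_le_right _ _)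
        have h2 : dist q p ≤ dist s q + dist s p := by
          rw [dist_comm s q]; exact dist_triangle _ _ _
        exact (min_le_right _ _).trans (by linarith)) (A 0 : M)
  let c : ℤ → M := fun k ↦ match k with
    | Int.ofNat n => A n
    | Int.negSucc n => b (n + 1)
  have hc : ∀ k, g.ChronologicallyPrecedes (c k) (c (k + 1)) := by
    rintro (n | _ | n)
    · exact hA n
    · change g.ChronologicallyPrecedes (b 1) (A 0 : M)
      rw [← hb0]
      exact hb 0
    · exact hb (n + 1)
  obtain ⟨γ, hγ, hγc⟩ := exists_timelike_curve hc
  have hγA (n : ℕ) : γ n = A n := hγc (n : ℤ)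
  have hγb (n : ℕ) : γ (-((n + 1 : ℕ) : ℝ)) = b (n + 1) := by
    have := hγc (Int.negSucc n)
    rwa [Int.cast_negSucc] at this
  have hfut : FutureInextensible γ univ := by
    rintro ⟨p, hp⟩
    apply hu p
    have hγp : Filter.Tendsto γ Filter.atTop (𝓝 p) := fun U hU ↦ by
      obtain ⟨t₀, -, ht₀⟩ := hp U hU
      exact Filter.mem_atTop_sets.2 ⟨t₀, fun t ht ↦ ht₀ t trivial ht⟩
    have hAp : Filter.Tendsto (fun n ↦ (A n : M)) Filter.atTop (𝓝 p) := by
      have := hγp.comp tendsto_natCast_atTop_atTop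
      refine this.congr fun n ↦ hγA n
    refine (tendsto_iff_of_dist ?_).1 hAp
    exact squeeze_zero (fun _ ↦ dist_nonneg) (fun n ↦ (A n).2.2.le)
      tendsto_one_div_add_atTop_nhds_zero_nat
  have hpast : PastInextensible γ univ := by
    rintro ⟨p, hp⟩
    apply hbconv p
    have hγp : Filter.Tendsto γ Filter.atBot (𝓝 p) := fun U hU ↦ by
      obtain ⟨t₀, -, ht₀⟩ := hp U hU
      exact Filter.mem_atBot_sets.2 ⟨t₀, fun t ht ↦ ht₀ t trivial ht⟩
    rw [← Filter.tendsto_add_atTop_iff_nat 1]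
    have h1 : Filter.Tendsto (fun n : ℕ ↦ -((n + 1 : ℕ) : ℝ)) Filter.atTop Filter.atBot :=
      Filter.tendsto_neg_atTop_atBot.comp
        (tendsto_natCast_atTop_atTop.comp (Filter.tendsto_add_atTop_nat 1))
    exact (hγp.comp h1).congr fun n ↦ hγb n
  have hγc' := hγ.mono_cone (C' := g.FutureCausal) fun x v h ↦ h.futureCausal
  -- γ is inextensible in both directions, so it does not matter which domain of dependence contains
  -- γ 0.
  have hmeet : (γ '' univ ∩ S).Nonempty := by
    have h0 : γ 0 ∈ γ '' univ := ⟨0, trivial, rfl⟩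
    rcases (eq_univ_iff_forall.1 hS.2.2) (γ 0) with h | h
    · exact h γ univ ordConnected_univ hγc' hpast h0
    · exact h γ univ ordConnected_univ hγc' hfut h0
  obtain ⟨_, ⟨t, -, rfl⟩, htS⟩ := hmeet
  obtain ⟨n, hn⟩ := exists_nat_gt t
  have htn : g.ChronologicallyPrecedes (γ t) (A n) := by
    rw [← hγA, chronologicallyPrecedes_iff]
    exact ((hγ.mono_set (subset_univ _)).reachableIn hn g.futureTimelike_smul).mono
      (subset_univ _)
  -- γ t ≪ z n and openness give γ t ≪ f x for 𝒰-almost every x, where f is the choice in state n; f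
  -- x causally precedes x, and push-up concludes.
  have hev := (u n).2.1.eventually (htn.trans (A n).2.1).eventually
  filter_upwards [hev, (u n).2.2] with x hx1 hx2
  exact ⟨γ t, htS, hx1.trans_causal hx2⟩

end Spacetime

/-! ### Compactness of causal diamonds. -/

namespace Spacetime

variable {M : Type*} [TopologicalSpace M] [ChartedSpace E4 M] [IsManifold (𝓡 4) ∞ M]
  [T2Space M] [SecondCountableTopology M] {g : Spacetime M} {S K L : Set M}

/-- Otherwise some ultrafilter contains this difference and escapes all compact sets, but then it
also contains I⁺(S). -/
lemma IsCauchyHypersurface.exists_compact_future (hS : g.IsCauchyHypersurface S)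
    (hK : IsCompact K) :
    ∃ C, IsCompact C ∧ g.causalFuture K \ g.chronologicalFuture S ⊆ C := by
  by_contra! h
  have hne : (Filter.cocompact M ⊓
      Filter.principal (g.causalFuture K \ g.chronologicalFuture S)).NeBot := by
    refine Filter.inf_principal_neBot_iff.2 fun U hU ↦ ?_
    obtain ⟨C, hC, hCU⟩ := Filter.mem_cocompact.1 hU
    obtain ⟨x, hx, hxC⟩ := not_subset.1 (h C hC)
    exact ⟨x, hCU hxC, hx⟩
  have hle := Ultrafilter.of_le (Filter.cocompact M ⊓
    Filter.principal (g.causalFuture K \ g.chronologicalFuture S))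
  set 𝒰 := Ultrafilter.of (Filter.cocompact M ⊓
    Filter.principal (g.causalFuture K \ g.chronologicalFuture S))
  have hmem : g.causalFuture K \ g.chronologicalFuture S ∈ 𝒰 :=
    Filter.le_principal_iff.1 (hle.trans inf_le_right)
  have h1 := hS.mem_ultrafilter hK 𝒰 (hle.trans inf_le_left)
    (Filter.mem_of_superset hmem sdiff_subset)
  obtain ⟨x, hx1, hx2⟩ := Filter.nonempty_of_mem (Filter.inter_mem h1 hmem)
  exact hx2.2 hx1

lemma IsCauchyHypersurface.exists_compact_past (hS : g.IsCauchyHypersurface S)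
    (hK : IsCompact K) :
    ∃ C, IsCompact C ∧ g.causalPast K \ g.chronologicalPast S ⊆ C := by
  have := hS.reverse.exists_compact_future hK
  rwa [reverse_causalFuture, reverse_chronologicalFuture] at this

/-- Causal diamonds in a globally hyperbolic spacetime are relatively compact. -/
lemma GloballyHyperbolic.exists_compact_diamond (hg : g.GloballyHyperbolic) (hK : IsCompact K)
    (hL : IsCompact L) : ∃ C, IsCompact C ∧ g.causalFuture K ∩ g.causalPast L ⊆ C := by
  obtain ⟨S, hS⟩ := hg
  obtain ⟨C, hC, hKC⟩ := hS.exists_compact_future hK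
  obtain ⟨D, hD, hLD⟩ := hS.exists_compact_past hL
  refine ⟨C ∪ D, hC.union hD, fun x hx ↦ ?_⟩
  -- Achronality: a point of I⁺(S) is outside I⁻(S), so the past bound applies to it.
  by_cases h : x ∈ g.chronologicalFuture S
  · exact Or.inr (hLD ⟨hx.2, Set.disjoint_left.1 hS.2.1.disjoint h⟩)
  · exact Or.inl (hKC ⟨hx.1, h⟩)

end Spacetime

/-! ### The volume measure is locally finite and positive on open sets. -/

namespace Spacetime

section Volume

/-- The inverse chart is continuous only on the target, but the measure lives there. -/
lemma aemeasurable_chartAt_symm {M : Type*} [TopologicalSpace M] [ChartedSpace E4 M] [MeasurableSpace M]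
    [BorelSpace M] (c : M) {f : E4 → ENNReal} :
    AEMeasurable (chartAt E4 c).symm
      ((volume.restrict (chartAt E4 c).target).withDensity f) :=
  ((chartAt E4 c).symm.continuousOn.aemeasurable
    (chartAt E4 c).open_target.measurableSet).mono_ac (withDensity_absolutelyContinuous _ _)

variable {M : Type*} [TopologicalSpace M] [ChartedSpace E4 M] [IsManifold (𝓡 4) ∞ M]
  (g : Spacetime M)

lemma eq_zero_of_metric_eq_zero {x : M} {v : TangentSpace (𝓡 4) x}
    (h : ∀ w, g.metric x w v = 0) : v = 0 :=
  g.eq_zero_of_orthogonal (g.timelike_timeField x) (h v).le (h _)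

lemma volumeDensity_eq (c : M) (z : E4) : g.volumeDensity c z =
    √|(Matrix.of fun i j : Fin 4 ↦ g.coordMetric c z (EuclideanSpace.single i (1 : ℝ))
      (EuclideanSpace.single j (1 : ℝ))).det| := rfl

lemma continuousOn_volumeDensity (c : M) :
    ContinuousOn (g.volumeDensity c) (chartAt E4 c).target := by
  have h := (g.contDiffOn_coordMetric c).continuousOn
  have hd : ContinuousOn (fun z ↦ (Matrix.of fun i j : Fin 4 ↦ g.coordMetric c z
      (EuclideanSpace.single i (1 : ℝ)) (EuclideanSpace.single j (1 : ℝ))).det)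
      (chartAt E4 c).target := by
    simp only [Matrix.det_apply, Matrix.of_apply]
    refine continuousOn_finsetSum _ fun σ _ ↦ ContinuousOn.const_smul ?_ _
    exact continuousOn_finsetProd _ fun i _ ↦
      (h.clm_apply continuousOn_const).clm_apply continuousOn_const
  exact Real.continuous_sqrt.comp_continuousOn hd.abs

/-- A kernel vector of the Gram matrix would be orthogonal to every tangent vector, against
nondegeneracy of the metric. -/
lemma volumeDensity_pos (c : M) {z : E4} (hz : z ∈ (chartAt E4 c).target) :
    0 < g.volumeDensity c z := by
  rw [volumeDensity_eq, Real.sqrt_pos, abs_pos]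
  intro h
  obtain ⟨v, hv, hv0⟩ := Matrix.exists_mulVec_eq_zero_iff.2 h
  obtain ⟨w, hw⟩ : ∃ w : E4, w = ∑ j, v j • EuclideanSpace.single j (1 : ℝ) := ⟨_, rfl⟩
  have h1 (i : Fin 4) : g.coordMetric c z (EuclideanSpace.single i (1 : ℝ)) w = 0 := by
    have := congrFun hv0 i
    simp only [Matrix.mulVec, dotProduct, Matrix.of_apply, Pi.zero_apply] at this
    rw [hw, map_sum, ← this]
    exact Finset.sum_congr rfl fun j _ ↦ by rw [map_smul, smul_eq_mul, mul_comm]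
  have h2 (u : E4) : g.coordMetric c z u w = 0 := by
    have hu : u = ∑ i, u i • EuclideanSpace.single i (1 : ℝ) := by
      ext k
      simp [Finset.sum_apply, Pi.single_apply]
    rw [hu, map_sum, sum_apply]
    exact Finset.sum_eq_zero fun i _ ↦ by rw [map_smul, smul_apply, h1, smul_zero]
  have h3 : frame c z w = 0 := by
    refine g.eq_zero_of_metric_eq_zero fun t ↦ ?_
    let G : E4 →L[ℝ] E4 →L[ℝ] ℝ := g.metric ((chartAt E4 c).symm z)
    let u : E4 := mfderiv (𝓡 4) (𝓡 4) (chartAt E4 c) ((chartAt E4 c).symm z) t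
    have ht : (frame c z u : E4) = t := by
      have e := DFunLike.congr_fun ((mdifferentiable_chart (I := 𝓡 4) c).symm_comp_deriv
        ((chartAt E4 c).map_target hz)) t
      rw [(chartAt E4 c).right_inv hz] at e
      exact e
    exact (congrArg (fun a : E4 ↦ G a (frame c z w)) ht).symm.trans (h2 u)
  have h4 : w = 0 := by
    rw [← mfderiv_frame c hz w, h3]
    exact map_zero _
  refine hv (funext fun k ↦ ?_)
  have : w k = 0 := by rw [h4]; rfl
  simpa [hw, Finset.sum_apply, Pi.single_apply] using this

lemma chartPartition_isSubordinate [T2Space M] [SecondCountableTopology M] :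
    (chartPartition M).IsSubordinate fun c ↦ (chartAt E4 c).source :=
  have : LocallyCompactSpace M := Manifold.locallyCompact_of_finiteDimensional (𝓡 4)
  (SmoothPartitionOfUnity.exists_isSubordinate_chartAt_source (𝓡 4) M).choose_spec

variable [MeasurableSpace M] [BorelSpace M]

/-- The density is continuous, hence bounded on a closed coordinate ball inside the target. -/
lemma exists_chartVolume_lt_top (c : M) {x : M} (hx : x ∈ (chartAt E4 c).source) :
    ∃ V, IsOpen V ∧ x ∈ V ∧ g.chartVolume c V < ⊤ := by
  set φ := chartAt E4 c with hφ
  obtain ⟨r, hr, hball⟩ := Metric.nhds_basis_closedBall.mem_iff.1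
    (φ.open_target.mem_nhds (φ.map_source hx))
  have hV : IsOpen (φ.source ∩ φ ⁻¹' Metric.ball (φ x) r) :=
    φ.isOpen_inter_preimage Metric.isOpen_ball
  refine ⟨_, hV, ⟨hx, Metric.mem_ball_self hr⟩, ?_⟩
  rw [chartVolume, Measure.map_apply_of_aemeasurable (aemeasurable_chartAt_symm c)
    hV.measurableSet]
  set ν := (volume.restrict φ.target).withDensity fun z ↦ ENNReal.ofReal (g.volumeDensity c z)
  have h0 : ν φ.targetᶜ = 0 := by
    refine withDensity_absolutelyContinuous _ _ ?_
    rw [Measure.restrict_apply φ.open_target.measurableSet.compl]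
    simp
  have hsub : φ.symm ⁻¹' (φ.source ∩ φ ⁻¹' Metric.ball (φ x) r) ⊆
      Metric.closedBall (φ x) r ∪ φ.targetᶜ := by
    rintro z ⟨-, hz⟩
    by_cases h : z ∈ φ.target
    · left
      have hz' : φ (φ.symm z) ∈ Metric.ball (φ x) r := hz
      rw [φ.right_inv h] at hz'
      exact Metric.ball_subset_closedBall hz'
    · exact Or.inr h
  refine (measure_mono hsub).trans_lt ((measure_union_le _ _).trans_lt ?_)
  rw [h0, add_zero, withDensity_apply _ Metric.isClosed_closedBall.measurableSet,
    Measure.restrict_restrict_of_subset hball]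
  refine setLIntegral_lt_top_of_bddAbove measure_closedBall_lt_top.ne
    (f := fun z ↦ (g.volumeDensity c z).toNNReal) ?_
  exact (isCompact_closedBall _ _).bddAbove_image
    (continuous_real_toNNReal.comp_continuousOn ((g.continuousOn_volumeDensity c).mono hball))

lemma chartVolume_pos (c : M) {V : Set M} (hV : IsOpen V) (hVs : V ⊆ (chartAt E4 c).source)
    (hne : V.Nonempty) : g.chartVolume c V ≠ 0 := by
  set φ := chartAt E4 c with hφ
  rw [chartVolume, Measure.map_apply_of_aemeasurable (aemeasurable_chartAt_symm c)
    hV.measurableSet]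
  have hmeas : AEMeasurable (fun z ↦ ENNReal.ofReal (g.volumeDensity c z))
      (volume.restrict φ.target) :=
    ((g.continuousOn_volumeDensity c).aemeasurable φ.open_target.measurableSet).ennreal_ofReal
  rw [Ne, withDensity_apply_eq_zero' hmeas]
  intro h
  have hW : IsOpen (φ.target ∩ φ.symm ⁻¹' V) := φ.symm.isOpen_inter_preimage hV
  have hWne : (φ.target ∩ φ.symm ⁻¹' V).Nonempty := by
    obtain ⟨x, hx⟩ := hne
    exact ⟨φ x, φ.map_source (hVs hx), by rwa [mem_preimage, φ.left_inv (hVs hx)]⟩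
  refine (hW.measure_pos volume hWne).ne' ?_
  have hsub : φ.target ∩ φ.symm ⁻¹' V ⊆
      {x | ENNReal.ofReal (g.volumeDensity c x) ≠ 0} ∩ φ.symm ⁻¹' V :=
    fun z hz ↦ ⟨by simpa using g.volumeDensity_pos c hz.1, hz.2⟩
  have h2 := measure_mono_null hsub h
  rwa [Measure.restrict_apply hW.measurableSet, inter_eq_left.2 inter_subset_left] at h2

variable [T2Space M] [SecondCountableTopology M]

lemma measurable_chartPartition (c : M) :
    Measurable fun x ↦ ENNReal.ofReal (chartPartition M c x) :=
  ((chartPartition M c).contMDiff.continuous.measurable).ennreal_ofReal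

/-- Near x only finitely many terms of the sum are nonzero. Each is finite near x: by the chart
volume if x is in the chart, and because its weight vanishes near x otherwise. -/
instance isLocallyFiniteMeasure_volumeMeasure : IsLocallyFiniteMeasure g.volumeMeasure := by
  refine ⟨fun x ↦ ?_⟩
  obtain ⟨V₀, hV₀, hfin⟩ := (chartPartition M).locallyFinite x
  have hloc (c : M) : ∃ V, IsOpen V ∧ x ∈ V ∧ ((g.chartVolume c).withDensity
      fun x ↦ ENNReal.ofReal (chartPartition M c x)) V < ⊤ := by
    by_cases hx : x ∈ (chartAt E4 c).source
    · obtain ⟨V, hV, hxV, hlt⟩ := g.exists_chartVolume_lt_top c hx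
      refine ⟨V, hV, hxV, lt_of_le_of_lt ?_ hlt⟩
      rw [withDensity_apply _ hV.measurableSet]
      refine (lintegral_mono (g := fun _ ↦ 1) fun y ↦ ?_).trans (by simp)
      exact ENNReal.ofReal_le_one.2 ((chartPartition M).le_one c y)
    · refine ⟨(tsupport (chartPartition M c))ᶜ, (isClosed_tsupport _).isOpen_compl,
        fun h ↦ hx (chartPartition_isSubordinate c h), ?_⟩
      rw [(withDensity_apply_eq_zero (measurable_chartPartition c)).2]
      · exact ENNReal.zero_lt_top
      · convert measure_empty (μ := g.chartVolume c)
        refine eq_empty_of_forall_notMem fun y hy ↦ hy.2 (subset_tsupport _ fun h ↦ hy.1 ?_)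
        simp [h]
  choose V hV hxV hlt using hloc
  refine ⟨interior V₀ ∩ ⋂ c ∈ hfin.toFinset, V c, Filter.inter_mem (interior_mem_nhds.2 hV₀)
    ((Filter.biInter_finset_mem _).2 fun c _ ↦ (hV c).mem_nhds (hxV c)), ?_⟩
  have hmeas : MeasurableSet (interior V₀ ∩ ⋂ c ∈ hfin.toFinset, V c) :=
    isOpen_interior.measurableSet.inter
      (Finset.measurableSet_biInter _ fun c _ ↦ (hV c).measurableSet)
  rw [volumeMeasure, Measure.sum_apply _ hmeas, tsum_eq_sum (s := hfin.toFinset)]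
  · exact ENNReal.sum_lt_top.2 fun c hc ↦
      (measure_mono fun y hy ↦ mem_iInter₂.1 hy.2 c hc).trans_lt (hlt c)
  · intro c hc
    rw [withDensity_apply_eq_zero (measurable_chartPartition c)]
    convert measure_empty (μ := g.chartVolume c)
    refine eq_empty_of_forall_notMem fun y hy ↦ hc ?_
    rw [Set.Finite.mem_toFinset]
    exact ⟨y, fun h ↦ hy.1 (by simp [h]), interior_subset hy.2.1⟩

/-- At a point of U some partition function is positive, and the single corresponding term already
charges U. -/
instance isOpenPosMeasure_volumeMeasure : g.volumeMeasure.IsOpenPosMeasure := by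
  refine ⟨fun U hU hne h ↦ ?_⟩
  obtain ⟨x, hx⟩ := hne
  obtain ⟨c, hc⟩ := (chartPartition M).exists_pos_of_mem (mem_univ x)
  have hsupp : {x | 0 < chartPartition M c x} ⊆ (chartAt E4 c).source := fun y hy ↦
    chartPartition_isSubordinate c (subset_tsupport _ (ne_of_gt hy))
  have hopen : IsOpen ({x | 0 < chartPartition M c x} ∩ U) :=
    (isOpen_lt continuous_const (chartPartition M c).contMDiff.continuous).inter hU
  refine g.chartVolume_pos c hopen (inter_subset_left.trans hsupp) ⟨x, hc, hx⟩ ?_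
  rw [volumeMeasure, Measure.sum_apply _ hU.measurableSet, ENNReal.tsum_eq_zero] at h
  refine measure_mono_null ?_ ((withDensity_apply_eq_zero (measurable_chartPartition c)).1 (h c))
  exact fun y hy ↦ ⟨by simpa using hy.1, hy.2⟩

end Volume

end Spacetime

/-! ### Nondegeneracy of the pairing of sections. -/

section Pairing

variable {M : Type*} [TopologicalSpace M] [ChartedSpace E4 M]
  {F : Type*} [NormedAddCommGroup F] [NormedSpace ℝ F]
  {E : M → Type*} [TopologicalSpace (TotalSpace F E)] [∀ x, TopologicalSpace (E x)]
  [∀ x, AddCommGroup (E x)] [∀ x, Module ℝ (E x)]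
  [∀ x, IsTopologicalAddGroup (E x)] [∀ x, ContinuousSMul ℝ (E x)]
  [FiberBundle F E] [VectorBundle ℝ F E]

lemma BilinearForm.continuous_apply (b : BilinearForm F E) (σ τ : Sections M F E) :
    Continuous fun x ↦ b.form x (σ x) (τ x) := by
  have key := ContMDiff.clm_bundle_apply₂ (F₁ := F) (F₂ := F) (F₃ := ℝ) (E₁ := E) (E₂ := E)
    (E₃ := Bundle.Trivial M ℝ) b.contMDiff_form σ.contMDiff τ.contMDiff
  exact continuous_iff_continuousAt.2 fun x ↦ ((contMDiffAt_totalSpace).1 (key x)).2.continuousAt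

lemma BilinearForm.hasCompactSupport_apply [T2Space M] (b : BilinearForm F E) {σ τ : Sections M F E}
    (hσ : IsCompact (supp σ)) : HasCompactSupport fun x ↦ b.form x (σ x) (τ x) := by
  refine HasCompactSupport.intro hσ fun x hx ↦ ?_
  have : σ x = 0 := by
    by_contra h
    exact hx (subset_closure h)
  simp [this]

/-- Smooth sections are separated by pairing with compactly supported ones. -/
lemma eq_of_pairing_eq [IsManifold (𝓡 4) ∞ M] [T2Space M] [SecondCountableTopology M]
    [MeasurableSpace M] [BorelSpace M] [ContMDiffVectorBundle ∞ F E (𝓡 4)] (g : Spacetime M)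
    (b : BilinearForm F E) {τ τ' : Sections M F E}
    (h : ∀ σ ∈ compactSections M F E, pairing g b σ τ = pairing g b σ τ') : τ = τ' := by
  ext x₀
  by_contra hne
  have hd : (τ - τ') x₀ ≠ 0 := sub_ne_zero.2 hne
  obtain ⟨w, hw⟩ : ∃ w : E x₀, 0 < b.form x₀ w ((τ - τ') x₀) := by
    by_contra! hall
    have hz : ∀ w : E x₀, b.form x₀ w ((τ - τ') x₀) = 0 := fun w ↦
      le_antisymm (hall w) (by have := hall (-w); simpa using this)
    refine hd (b.nondegenerate x₀ _ fun w ↦ ?_)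
    -- Nondegeneracy is given in the first argument; (anti)symmetry transfers it to the second.
    rcases b.bosonic_or_fermionic with hb | hb
    · rw [hb, hz]
    · rw [hb, hz, neg_zero]
  obtain ⟨N, hN, hext⟩ := FiberBundle.exists_contMDiffOn_extend (𝓡 4) F (k := ∞) w
  set e : ∀ x, E x := FiberBundle.extend F w with he
  have hval : ContinuousAt (fun x ↦ b.form x (e x) ((τ - τ') x)) x₀ := by
    have key := ContMDiffAt.clm_bundle_apply₂ (F₁ := F) (F₂ := F) (F₃ := ℝ) (E₁ := E) (E₂ := E)
      (E₃ := Bundle.Trivial M ℝ) b.contMDiff_form.contMDiffAt (hext.contMDiffAt hN)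
      ((τ - τ').contMDiff x₀)
    exact ((contMDiffAt_totalSpace).1 key).2.continuousAt
  have hpos : ∀ᶠ x in 𝓝 x₀, 0 < b.form x (e x) ((τ - τ') x) := by
    refine hval.eventually (lt_mem_nhds ?_)
    simpa [he] using hw
  -- The bump is supported where the extension of w is smooth and its pairing with τ - τ' is
  -- positive, so the integrand below is nonnegative and positive at x₀.
  obtain ⟨f, -, hf⟩ := (SmoothBumpFunction.nhds_basis_tsupport (I := 𝓡 4) x₀).mem_iff.1
    (Filter.inter_mem (interior_mem_nhds.2 hN) hpos)
  let σ : Sections M F E := ⟨fun x ↦ f x • e x, by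
    intro x
    by_cases hx : x ∈ tsupport f
    · exact (f.contMDiff x).smul_section (hext.contMDiffAt (mem_interior_iff_mem_nhds.1 (hf hx).1))
    · have hz : (fun x ↦ TotalSpace.mk' F x (f x • e x)) =ᶠ[𝓝 x]
          fun x ↦ TotalSpace.mk' F x ((0 : Sections M F E) x) := by
        filter_upwards [(isClosed_tsupport f).isOpen_compl.mem_nhds hx] with y hy
        rw [image_eq_zero_of_notMem_tsupport hy, zero_smul]
        rfl
      exact ((0 : Sections M F E).contMDiff x).congr_of_eventuallyEq hz⟩
  have hσ (x : M) : σ x = f x • e x := rfl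
  have hσc : IsCompact (supp σ) := by
    refine f.hasCompactSupport.isCompact.of_isClosed_subset isClosed_closure
      (closure_mono fun x hx hfx ↦ hx ?_)
    rw [hσ, hfx, zero_smul]
  have hint (ρ : Sections M F E) : Integrable (fun x ↦ b.form x (σ x) (ρ x)) g.volumeMeasure :=
    (b.continuous_apply σ ρ).integrable_of_hasCompactSupport (b.hasCompactSupport_apply hσc)
  have h0 : ∫ x, b.form x (σ x) ((τ - τ') x) ∂g.volumeMeasure = 0 := by
    have e1 : (fun x ↦ b.form x (σ x) ((τ - τ') x)) =
        fun x ↦ b.form x (σ x) (τ x) - b.form x (σ x) (τ' x) := by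
      ext x
      rw [← map_sub]
      rfl
    rw [e1, integral_sub (hint τ) (hint τ')]
    exact sub_eq_zero.2 (h σ hσc)
  refine ((b.continuous_apply σ (τ - τ')).integral_pos_of_hasCompactSupport_nonneg_nonzero
    (μ := g.volumeMeasure) (b.hasCompactSupport_apply hσc) (fun x ↦ ?_) (x := x₀) ?_).ne' h0
  · rw [hσ, map_smul, smul_apply, smul_eq_mul]
    by_cases hx : x ∈ tsupport f
    · exact mul_nonneg f.nonneg (le_of_lt (hf hx).2)
    · simp [image_eq_zero_of_notMem_tsupport hx]
  · rw [hσ, f.eq_one, one_smul, he, FiberBundle.extend_apply_self]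
    exact hw.ne'

end Pairing

lemma isCompact_inter_of_subset {X : Type*} [TopologicalSpace X] {s t A B C : Set X}
    (hs : IsClosed s) (ht : IsClosed t) (hC : IsCompact C) (hsA : s ⊆ A) (htB : t ⊆ B)
    (h : A ∩ B ⊆ C) : IsCompact (s ∩ t) :=
  hC.of_isClosed_subset (hs.inter ht) ((inter_subset_inter hsA htB).trans h)

/-! ### Green operators and the causal propagator. -/

section Green

variable {M : Type*} [TopologicalSpace M] [ChartedSpace E4 M]
  {F : Type*} [NormedAddCommGroup F] [NormedSpace ℝ F]
  {E : M → Type*} [TopologicalSpace (TotalSpace F E)] [∀ x, TopologicalSpace (E x)]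
  [∀ x, AddCommGroup (E x)] [∀ x, Module ℝ (E x)]
  [FiberBundle F E] [VectorBundle ℝ F E]

lemma supp_neg (σ : Sections M F E) : supp (-σ) = supp σ := by
  simp [supp]

lemma supp_sub_subset (σ τ : Sections M F E) : supp (σ - τ) ⊆ supp σ ∪ supp τ := by
  rw [sub_eq_add_neg, ← supp_neg τ]
  exact supp_add_subset σ (-τ)

variable [IsManifold (𝓡 4) ∞ M]

lemma Spacetime.causalFuture_mono (g : Spacetime M) {K L : Set M} (h : K ⊆ L) :
    g.causalFuture K ⊆ g.causalFuture L := fun _ ⟨p, hp, hx⟩ ↦ ⟨p, h hp, hx⟩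

lemma Spacetime.causalPast_mono (g : Spacetime M) {K L : Set M} (h : K ⊆ L) :
    g.causalPast K ⊆ g.causalPast L := fun _ ⟨p, hp, hx⟩ ↦ ⟨p, h hp, hx⟩

lemma Spacetime.subset_causalFuture (g : Spacetime M) (K : Set M) : K ⊆ g.causalFuture K :=
  fun x hx ↦ ⟨x, hx, .refl x⟩

lemma Spacetime.subset_causalPast (g : Spacetime M) (K : Set M) : K ⊆ g.causalPast K :=
  fun x hx ↦ ⟨x, hx, .refl x⟩

lemma IsCausalPropagator.mem_solutionsSC {g : Spacetime M} {P : DiffOp M F E}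
    {G : compactSections M F E →ₗ[ℝ] Sections M F E} (hG : IsCausalPropagator g P G)
    (f : compactSections M F E) : G f ∈ solutionsSC g P := by
  obtain ⟨Gp, Gm, hp, hm, rfl⟩ := hG
  refine ⟨?_, supp (f : Sections M F E), f.2, ?_⟩
  · rw [LinearMap.sub_apply, map_sub, hp.right_inv, hm.right_inv, sub_self]
  · exact (supp_sub_subset _ _).trans (union_subset_union (hp.supp_subset f) (hm.supp_subset f))

variable [T2Space M] [SecondCountableTopology M]

/-- If the advanced and retarded images of f agree, their support is closed in a relatively compact
diamond, so this common image is a compactly supported preimage of f under P. -/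
lemma IsCausalPropagator.ker_eq {g : Spacetime M} {P : DiffOp M F E}
    {G : compactSections M F E →ₗ[ℝ] Sections M F E} (hg : g.GloballyHyperbolic) (hG : IsCausalPropagator g P G) :
    LinearMap.ker G = LinearMap.range P.onCompact := by
  obtain ⟨Gp, Gm, hp, hm, rfl⟩ := hG
  ext f
  rw [LinearMap.mem_ker, LinearMap.sub_apply, sub_eq_zero]
  constructor
  · intro h
    obtain ⟨C, hC, hsub⟩ := hg.exists_compact_diamond f.2 f.2
    have hc : IsCompact (supp (Gp f) ∩ supp (Gm f)) :=
      isCompact_inter_of_subset isClosed_closure isClosed_closure hC (hp.supp_subset f) (hm.supp_subset f) hsub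
    rw [← h, inter_self] at hc
    exact ⟨⟨Gp f, hc⟩, Subtype.ext (hp.right_inv f)⟩
  · rintro ⟨f, rfl⟩
    rw [hp.left_inv, hm.left_inv]

section Uniqueness

variable [MeasurableSpace M] [BorelSpace M]
  [∀ x, IsTopologicalAddGroup (E x)] [∀ x, ContinuousSMul ℝ (E x)]
  [ContMDiffVectorBundle ∞ F E (𝓡 4)] {g : Spacetime M} {b : BilinearForm F E}
  {P Q : DiffOp M F E}

/-- A right inverse of the formal adjoint gives uniqueness for sections whose supports meet those
in the image of this inverse in compact sets. -/
lemma IsFormalAdjoint.injOn (hadj : IsFormalAdjoint g b P Q)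
    {H : compactSections M F E → Sections M F E} (hH : ∀ w, Q (H w) = w) {u v : Sections M F E}
    (hu : ∀ w, IsCompact (supp (H w) ∩ supp u)) (hv : ∀ w, IsCompact (supp (H w) ∩ supp v))
    (h : P u = P v) : u = v := by
  refine eq_of_pairing_eq g b fun σ hσ ↦ ?_
  have h1 := hadj _ _ (hu ⟨σ, hσ⟩)
  have h2 := hadj _ _ (hv ⟨σ, hσ⟩)
  rw [hH] at h1 h2
  rw [h1, h2, h]

/-- Future supports are tested with the retarded Green operator of the adjoint, so that the supports
meet inside a causal diamond. -/
lemma eq_of_supp_subset_causalFuture (hg : g.GloballyHyperbolic) (hadj : IsFormalAdjoint g b P Q)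
    {H : compactSections M F E →ₗ[ℝ] Sections M F E} (hH : IsRetardedGreen g Q H)
    {u v : Sections M F E} {K L : Set M} (hK : IsCompact K) (hL : IsCompact L)
    (hu : supp u ⊆ g.causalFuture K) (hv : supp v ⊆ g.causalFuture L) (h : P u = P v) : u = v := by
  refine hadj.injOn hH.right_inv (fun w ↦ ?_) (fun w ↦ ?_) h
  · obtain ⟨C, hC, hsub⟩ := hg.exists_compact_diamond hK w.2
    exact isCompact_inter_of_subset isClosed_closure isClosed_closure hC (hH.supp_subset w) hu (by rwa [inter_comm])
  · obtain ⟨C, hC, hsub⟩ := hg.exists_compact_diamond hL w.2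
    exact isCompact_inter_of_subset isClosed_closure isClosed_closure hC (hH.supp_subset w) hv (by rwa [inter_comm])

lemma eq_of_supp_subset_causalPast (hg : g.GloballyHyperbolic) (hadj : IsFormalAdjoint g b P Q)
    {H : compactSections M F E →ₗ[ℝ] Sections M F E} (hH : IsAdvancedGreen g Q H)
    {u v : Sections M F E} {K L : Set M} (hK : IsCompact K) (hL : IsCompact L)
    (hu : supp u ⊆ g.causalPast K) (hv : supp v ⊆ g.causalPast L) (h : P u = P v) : u = v := by
  refine hadj.injOn hH.right_inv (fun w ↦ ?_) (fun w ↦ ?_) h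
  · obtain ⟨C, hC, hsub⟩ := hg.exists_compact_diamond w.2 hK
    exact isCompact_inter_of_subset isClosed_closure isClosed_closure hC (hH.supp_subset w) hu hsub
  · obtain ⟨C, hC, hsub⟩ := hg.exists_compact_diamond w.2 hL
    exact isCompact_inter_of_subset isClosed_closure isClosed_closure hC (hH.supp_subset w) hv hsub

end Uniqueness

/-- A section with support in `J(K)` is the sum of one with support in `J⁺(K')` and one with
support in `J⁻(K')`, and the supports of the two have a compact intersection. -/
lemma exists_causal_splitting {g : Spacetime M} (hg : g.GloballyHyperbolic) {K : Set M}
    (hK : IsCompact K) {u : Sections M F E} (hu : supp u ⊆ g.causalHull K) :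
    ∃ (v w : Sections M F E) (L : Set M), IsCompact L ∧ u = v + w ∧
      supp v ⊆ g.causalFuture L ∧ supp w ⊆ g.causalPast L ∧ IsCompact (supp v ∩ supp w) := by
  have : LocallyCompactSpace M := Manifold.locallyCompact_of_finiteDimensional (𝓡 4)
  obtain ⟨S, hS⟩ := hg
  obtain ⟨C₁, hC₁, hsub₁⟩ := hS.exists_compact_future hK
  obtain ⟨C₂, hC₂, hsub₂⟩ := hS.exists_compact_past hK
  obtain ⟨C, hC, hsub⟩ := exists_compact_superset (hC₁.union hC₂)
  have key₁ : ∀ x ∈ g.causalFuture K, x ∉ interior C → x ∈ g.chronologicalFuture S := by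
    intro x hx hxC
    by_contra h
    exact hxC (hsub (Or.inl (hsub₁ ⟨hx, h⟩)))
  have key₂ : ∀ x ∈ g.causalPast K, x ∉ interior C → x ∈ g.chronologicalPast S := by
    intro x hx hxC
    by_contra h
    exact hxC (hsub (Or.inr (hsub₂ ⟨hx, h⟩)))
  -- Removing open sets from supp u gives closed sets; intersecting with J±(K) would require these
  -- to be closed. Outside the interior of C, J⁺(K) lies in I⁺(S) and J⁻(K) in I⁻(S), which puts Y₁
  -- in J⁺(K) and Y₂ in J⁻(K).
  set Y₁ := supp u \ (interior C ∪ g.chronologicalPast S) with hY₁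
  set Y₂ := supp u \ (interior C ∪ g.chronologicalFuture S) with hY₂
  have hcl₁ : IsClosed Y₁ :=
    isClosed_closure.sdiff (isOpen_interior.union (g.isOpen_chronologicalPast S))
  have hcl₂ : IsClosed Y₂ :=
    isClosed_closure.sdiff (isOpen_interior.union (g.isOpen_chronologicalFuture S))
  have hJ₁ : Y₁ ⊆ g.causalFuture K := by
    rintro x ⟨hx, hx'⟩
    simp only [mem_union, not_or] at hx'
    exact (hu hx).resolve_right fun h ↦ hx'.2 (key₂ x h hx'.1)
  have hJ₂ : Y₂ ⊆ g.causalPast K := by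
    rintro x ⟨hx, hx'⟩
    simp only [mem_union, not_or] at hx'
    exact (hu hx).resolve_left fun h ↦ hx'.2 (key₁ x h hx'.1)
  have hdisj : Disjoint Y₂ Y₁ := by
    refine Set.disjoint_left.2 fun x h₂ h₁ ↦ ?_
    have hxC : x ∉ interior C := fun h ↦ h₁.2 (Or.inl h)
    exact h₂.2 (Or.inr (key₁ x (hJ₁ h₁) hxC))
  have hcov : supp u ⊆ Y₁ ∪ Y₂ ∪ C := by
    intro x hx
    by_cases hxC : x ∈ interior C
    · exact Or.inr (interior_subset hxC)
    by_cases h : x ∈ g.chronologicalPast S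
    · refine Or.inl (Or.inr ⟨hx, ?_⟩)
      rintro (h' | h')
      exacts [hxC h', Set.disjoint_left.1 hS.2.1.disjoint h' h]
    · refine Or.inl (Or.inl ⟨hx, ?_⟩)
      rintro (h' | h')
      exacts [hxC h', h h']
  -- χ is 1 on the future part Y₁ and 0 on the past part Y₂; the transition within supp u takes
  -- place in C.
  obtain ⟨χ, hχ0, hχ1, -⟩ := exists_contMDiffMap_zero_one_of_isClosed (𝓡 4) (n := ⊤) hcl₂ hcl₁ hdisj
  let v : Sections M F E := ⟨fun x ↦ χ x • u x, χ.contMDiff.smul_section u.contMDiff⟩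
  have hv (x : M) : v x = χ x • u x := rfl
  have hsv : supp v ⊆ Y₁ ∪ C := by
    refine closure_minimal (fun x hx ↦ ?_) (hcl₁.union hC.isClosed)
    have hux : u x ≠ 0 := fun h ↦ hx (by rw [hv, h, smul_zero])
    rcases hcov (subset_closure hux) with (h | h) | h
    · exact Or.inl h
    · exact absurd (by rw [hv, hχ0 h, Pi.zero_apply, zero_smul]) hx
    · exact Or.inr h
  have hsw : supp (u - v) ⊆ Y₂ ∪ C := by
    refine closure_minimal (fun x hx ↦ ?_) (hcl₂.union hC.isClosed)
    have hx' : u x - χ x • u x ≠ 0 := hx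
    have hux : u x ≠ 0 := fun h ↦ hx' (by rw [h, smul_zero, sub_zero])
    rcases hcov (subset_closure hux) with (h | h) | h
    · exact absurd (by rw [hχ1 h, Pi.one_apply, one_smul, sub_self]) hx'
    · exact Or.inl h
    · exact Or.inr h
  refine ⟨v, u - v, K ∪ C, hK.union hC, by abel, hsv.trans (union_subset ?_ ?_),
    hsw.trans (union_subset ?_ ?_), isCompact_inter_of_subset isClosed_closure isClosed_closure hC hsv hsw ?_⟩
  · exact hJ₁.trans (g.causalFuture_mono subset_union_left)
  · exact subset_union_right.trans (g.subset_causalFuture _)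
  · exact hJ₂.trans (g.causalPast_mono subset_union_left)
  · exact subset_union_right.trans (g.subset_causalPast _)
  · rintro x ⟨h₁ | h₁, h₂ | h₂⟩
    exacts [absurd h₁ (Set.disjoint_left.1 hdisj h₂), h₂, h₁, h₁]

section Propagator

variable [MeasurableSpace M] [BorelSpace M]
  [∀ x, IsTopologicalAddGroup (E x)] [∀ x, ContinuousSMul ℝ (E x)]
  [ContMDiffVectorBundle ∞ F E (𝓡 4)] {g : Spacetime M} {b : BilinearForm F E}
  {P Q : DiffOp M F E} {G : compactSections M F E →ₗ[ℝ] Sections M F E}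

lemma IsCausalPropagator.unique {G' : compactSections M F E →ₗ[ℝ] Sections M F E}
    (hg : g.GloballyHyperbolic) (hadj : IsFormalAdjoint g b P Q) (hQ : GreenHyperbolic g Q)
    (hG : IsCausalPropagator g P G) (hG' : IsCausalPropagator g P G') : G = G' := by
  obtain ⟨Gp, Gm, hp, hm, rfl⟩ := hG
  obtain ⟨Gp', Gm', hp', hm', rfl⟩ := hG'
  obtain ⟨⟨Hp, hHp⟩, ⟨Hm, hHm⟩⟩ := hQ
  have e₁ : Gp = Gp' := LinearMap.ext fun f ↦ eq_of_supp_subset_causalFuture hg hadj hHm f.2 f.2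
    (hp.supp_subset f) (hp'.supp_subset f) (by rw [hp.right_inv, hp'.right_inv])
  have e₂ : Gm = Gm' := LinearMap.ext fun f ↦ eq_of_supp_subset_causalPast hg hadj hHp f.2 f.2
    (hm.supp_subset f) (hm'.supp_subset f) (by rw [hm.right_inv, hm'.right_inv])
  rw [e₁, e₂]

/-- With u = v + w split causally, Pv = -Pw is supported in supp v ∩ supp w, so f = Pv is an
admissible source. Uniqueness identifies its advanced image with v and its retarded image with -w.
-/
lemma IsCausalPropagator.exists_eq (hg : g.GloballyHyperbolic) (hadj : IsFormalAdjoint g b P Q)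
    (hQ : GreenHyperbolic g Q) (hG : IsCausalPropagator g P G) {u : Sections M F E}
    (hu : u ∈ solutionsSC g P) : ∃ f, G f = u := by
  obtain ⟨Gp, Gm, hp, hm, rfl⟩ := hG
  obtain ⟨⟨Hp, hHp⟩, ⟨Hm, hHm⟩⟩ := hQ
  obtain ⟨hPu, K, hK, huK⟩ := hu
  obtain ⟨v, w, L, hL, rfl, hv, hw, hc⟩ := exists_causal_splitting hg hK huK
  have hvw : P v = P (-w) := by
    rw [map_neg, eq_neg_iff_add_eq_zero, ← map_add, hPu]
  have hf : P v ∈ compactSections M F E := by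
    refine hc.of_isClosed_subset isClosed_closure (subset_inter (P.supp_subset v) ?_)
    rw [hvw, ← supp_neg w]
    exact P.supp_subset (-w)
  refine ⟨⟨P v, hf⟩, ?_⟩
  have e₁ : Gp ⟨P v, hf⟩ = v := eq_of_supp_subset_causalFuture hg hadj hHm hf hL
    (hp.supp_subset _) hv (hp.right_inv _)
  have e₂ : Gm ⟨P v, hf⟩ = -w := eq_of_supp_subset_causalPast hg hadj hHp hf hL
    (hm.supp_subset _) (by rwa [supp_neg]) ((hm.right_inv _).trans hvw)
  rw [LinearMap.sub_apply, e₁, e₂, sub_neg_eq_add]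

end Propagator

end Green

end QFTCurved

theorem lemma3p1
    {M : Type*} [TopologicalSpace M] [ChartedSpace QFTCurved.E4 M] [IsManifold (𝓡 4) ∞ M]
    [T2Space M] [SecondCountableTopology M] [MeasurableSpace M] [BorelSpace M]
    {F : Type*} [NormedAddCommGroup F] [NormedSpace ℝ F] [FiniteDimensional ℝ F]
    {E : M → Type*} [TopologicalSpace (TotalSpace F E)] [∀ x, TopologicalSpace (E x)]
    [∀ x, AddCommGroup (E x)] [∀ x, Module ℝ (E x)]
    [∀ x, IsTopologicalAddGroup (E x)] [∀ x, ContinuousSMul ℝ (E x)]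
    [FiberBundle F E] [VectorBundle ℝ F E] [ContMDiffVectorBundle ∞ F E (𝓡 4)]
    (g : QFTCurved.Spacetime M) (hg : g.GloballyHyperbolic)
    (b : QFTCurved.BilinearForm F E)
    (P Pstar : QFTCurved.DiffOp M F E)
    (hP : QFTCurved.GreenHyperbolic g P)
    (hadj : QFTCurved.IsFormalAdjoint g b P Pstar)
    (hPstar : QFTCurved.GreenHyperbolic g Pstar) :
    (∃! G, QFTCurved.IsCausalPropagator g P G) ∧
    ∀ G, QFTCurved.IsCausalPropagator g P G →
      ∃ I : (QFTCurved.compactSections M F E ⧸ LinearMap.range P.onCompact) ≃ₗ[ℝ]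
          QFTCurved.solutionsSC g P,
        ∀ f : QFTCurved.compactSections M F E,
          (I (Submodule.Quotient.mk f) : QFTCurved.Sections M F E) = G f := by
  refine ⟨?_, fun G hG ↦ ?_⟩
  · obtain ⟨⟨Gp, hp⟩, ⟨Gm, hm⟩⟩ := hP
    have hG : QFTCurved.IsCausalPropagator g P (Gp - Gm) := ⟨Gp, Gm, hp, hm, rfl⟩
    exact ⟨Gp - Gm, hG, fun G' hG' ↦ hG'.unique hg hadj hPstar hG⟩
  -- The isomorphism is the first isomorphism theorem for G with its codomain cut down to the
  -- solution space.
  · let T : QFTCurved.compactSections M F E →ₗ[ℝ] QFTCurved.solutionsSC g P :=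
      G.codRestrict _ hG.mem_solutionsSC
    have hker : LinearMap.range P.onCompact = LinearMap.ker T := by
      rw [LinearMap.ker_codRestrict, hG.ker_eq hg]
    have hsurj : Function.Surjective T := by
      rintro ⟨u, hu⟩
      obtain ⟨f, hf⟩ := hG.exists_eq hg hadj hPstar hu
      exact ⟨f, Subtype.ext hf⟩
    exact ⟨(Submodule.quotEquivOfEq _ _ hker).trans (T.quotKerEquivOfSurjective hsurj),
      fun f ↦ rfl⟩
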